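/- Work in the universe $V$ of sets. All complete Boolean algebras are taken with $0\neq 1$. Let $\Gamma$ be a class of complete Boolean algebras defined by a formula of the language of set theory (possibly with a set parameter); in a forcing extension, $\Gamma$ denotes the class of complete Boolean algebras defined there by the same formula. Assume that $\Gamma$ contains trivial forcing after forcing with $\Gamma$: for every $\mathbb{P}\in\Gamma$, $V^{\mathbb{P}}\models$ "some two-element Boolean algebra belongs to $\Gamma$". Then the following are equivalent. (1) $\mathsf{FA}_{\aleph_1}(\Gamma)$: for every $\mathbb{P}\in\Gamma$ and every sequence $\langle D_\alpha \mid \alpha<\omega_1\rangle$ of maximal antichains of $\mathbb{P}$ with $|D_\alpha|\le\aleph_1$ for all $\alpha<\omega_1$, there is a (proper) filter $G\subseteq\mathbb{P}$ such that $G\cap D_\alpha\neq\emptyset$ for all $\alpha<\omega_1$. (2) $\mathrm{MP}_{\Sigma_1}(\omega_1,\Gamma)$: for every $\Sigma_1$ formula $\phi(v)$ of the language of set theory and every $A\subseteq\omega_1$, if there is $\mathbb{P}\in\Gamma$ such that $\phi(A)$ is $\Gamma$-necessary over $V^{\mathbb{P}}$, then $\phi(A)$ holds in $V$. Here "$\phi(A)$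 is $\Gamma$-necessary over $V^{\mathbb{P}}$" means that in $V^{\mathbb{P}}$, for every $\mathbb{Q}$ in $\Gamma$ as interpreted there, $\phi(A)$ is true in $V^{\mathbb{P}*\mathbb{Q}}$. -/

import Mathlib

open FirstOrder FirstOrder.Language Set

universe u

/-! ### The language of set theory and the Lévy classes -/

/-- The only symbol of the language of set theory: the binary relation `∈`. -/
inductive MemSymbol : ℕ → Type
  | mem : MemSymbol 2

/-- The first-order language of set theory. -/
def setLanguage : FirstOrder.Language := ⟨fun _ => Empty, MemSymbol⟩

/-- The universe of sets `V` as a structure for the language of set theory. -/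
instance zfsetStructure : setLanguage.Structure ZFSet.{u} where
  funMap f _ := Empty.elim f
  RelMap r xs := match r, xs with
    | MemSymbol.mem, xs => xs 0 ∈ xs 1

/-- The atomic formula `s ∈ t`. -/
def memFormula {α : Type} {n : ℕ} (s t : α ⊕ Fin n) : setLanguage.BoundedFormula α n :=
  BoundedFormula.rel (L := setLanguage) (MemSymbol.mem) ![Term.var s, Term.var t]

/-- `Σ₀` (that is, `Δ₀`) formulas: all quantifiers are bounded, i.e. of the form `∀ x ∈ t`
or `∃ x ∈ t` where `t` is a variable other than `x`. -/
inductive IsDelta0 {α : Type} : ∀ {n : ℕ}, setLanguage.BoundedFormula α n → Prop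
  | falsum {n : ℕ} : IsDelta0 (BoundedFormula.falsum : setLanguage.BoundedFormula α n)
  | equal {n : ℕ} (s t : setLanguage.Term (α ⊕ Fin n)) : IsDelta0 (BoundedFormula.equal s t)
  | rel {n k : ℕ} (r : setLanguage.Relations k) (ts : Fin k → setLanguage.Term (α ⊕ Fin n)) :
      IsDelta0 (BoundedFormula.rel r ts)
  | imp {n : ℕ} {φ ψ : setLanguage.BoundedFormula α n} :
      IsDelta0 φ → IsDelta0 ψ → IsDelta0 (φ.imp ψ)
  | ball {n : ℕ} (t : α ⊕ Fin n) {φ : setLanguage.BoundedFormula α (n + 1)} : IsDelta0 φ →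
      IsDelta0 ((memFormula (Sum.inr (Fin.last n)) (Sum.map id Fin.castSucc t)).imp φ).all
  | bex {n : ℕ} (t : α ⊕ Fin n) {φ : setLanguage.BoundedFormula α (n + 1)} : IsDelta0 φ →
      IsDelta0 ((memFormula (Sum.inr (Fin.last n)) (Sum.map id Fin.castSucc t)) ⊓ φ).ex

/-- `Σ₁` formulas: a (possibly empty) block of existential quantifiers in front of a
`Σ₀` formula. -/
inductive IsSigma1 {α : Type} : ∀ {n : ℕ}, setLanguage.BoundedFormula α n → Prop
  | delta0 {n : ℕ} {φ : setLanguage.BoundedFormula α n} : IsDelta0 φ → IsSigma1 φ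
  | ex {n : ℕ} {φ : setLanguage.BoundedFormula α (n + 1)} : IsSigma1 φ → IsSigma1 φ.ex

/-! ### Boolean-valued models -/

/-- The class `V^B` of `B`-names: a name is a family of names together with a Boolean value
attached to each member of the family. -/
inductive BName (B : Type u) : Type (u + 1)
  | mk (ι : Type u) (elt : ι → BName B) (val : ι → B) : BName B

namespace BName

/-- The index type of the domain of a name. -/
def Index {B : Type u} : BName B → Type u
  | mk ι _ _ => ι

/-- The names in the domain of a name. -/
def elt {B : Type u} : (x : BName B) → x.Index → BName B
  | mk _ elt _ => elt

/-- The Boolean values attached to the names in the domain of a name. -/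
def val {B : Type u} : (x : BName B) → x.Index → B
  | mk _ _ val => val

variable {B : Type u} [CompleteBooleanAlgebra B]

/-- The Boolean value `⟦x = y⟧`. -/
def eqVal : BName B → BName B → B
  | mk _ x v, mk _ y w =>
    (⨅ i, v i ⇨ ⨆ j, w j ⊓ eqVal (x i) (y j)) ⊓ (⨅ j, w j ⇨ ⨆ i, v i ⊓ eqVal (x i) (y j))

/-- The Boolean value `⟦x ∈ y⟧`. -/
def memVal (x y : BName B) : B := ⨆ j : y.Index, y.val j ⊓ eqVal x (y.elt j)

/-- The canonical name of a pre-set. -/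
def checkPSet (B : Type u) [CompleteBooleanAlgebra B] : PSet.{u} → BName B
  | PSet.mk ι A => mk ι (fun i => checkPSet B (A i)) (fun _ => ⊤)

/-- The canonical name `x̌` of a set `x` of the ground model. -/
noncomputable def check (B : Type u) [CompleteBooleanAlgebra B] (x : ZFSet.{u}) : BName B :=
  checkPSet B (Quotient.out x)

/-- The name of the unordered pair `{x, y}`. -/
def upair (x y : BName B) : BName B :=
  mk (ULift.{u} Bool) (fun i => if i.down then x else y) (fun _ => ⊤)

/-- The name of the (Kuratowski) ordered pair `(x, y) = {{x}, {x, y}}`. -/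
def opair (x y : BName B) : BName B := upair (upair x x) (upair x y)

/-- The value of a term (necessarily a variable) in `V^B`. -/
def termVal {β : Type} (v : β → BName B) : setLanguage.Term β → BName B
  | Term.var i => v i
  | Term.func f _ => Empty.elim f

/-- The Boolean value `⟦φ⟧` of a formula of the language of set theory in `V^B`. -/
noncomputable def truth {α : Type} : ∀ {n : ℕ}, setLanguage.BoundedFormula α n →
    (α → BName B) → (Fin n → BName B) → B
  | _, BoundedFormula.falsum, _, _ => ⊥
  | _, BoundedFormula.equal s t, v, xs =>
      eqVal (termVal (Sum.elim v xs) s) (termVal (Sum.elim v xs) t)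
  | _, BoundedFormula.rel r ts, v, xs => match r, ts with
      | MemSymbol.mem, ts =>
          memVal (termVal (Sum.elim v xs) (ts 0)) (termVal (Sum.elim v xs) (ts 1))
  | _, BoundedFormula.imp φ ψ, v, xs => truth φ v xs ⇨ truth ψ v xs
  | _, BoundedFormula.all φ, v, xs => ⨅ x : BName B, truth φ v (Fin.snoc xs x)

/-! ### Complete Boolean algebras inside `V^B`

In what follows `X` is a name for the underlying set and `R` a name for the order relation. -/

/-- `⟦x ≤ y⟧`, i.e. `⟦(x, y) ∈ R⟧`. -/
def leVal (R x y : BName B) : B := memVal (opair x y) R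

/-- `⟦S ⊆ X⟧`. -/
def subsetVal (S X : BName B) : B := ⨅ x : BName B, memVal x S ⇨ memVal x X

/-- `⟦R` is a partial order on `X⟧`. -/
def isPartialOrderVal (X R : BName B) : B :=
  (⨅ z : BName B, memVal z R ⇨
    ⨆ x : BName B, ⨆ y : BName B, memVal x X ⊓ memVal y X ⊓ eqVal z (opair x y)) ⊓
  (⨅ x : BName B, memVal x X ⇨ leVal R x x) ⊓
  (⨅ x : BName B, ⨅ y : BName B, ⨅ z : BName B, memVal x X ⊓ memVal y X ⊓ memVal z X ⇨
    (leVal R x y ⊓ leVal R y z ⇨ leVal R x z)) ⊓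
  (⨅ x : BName B, ⨅ y : BName B, memVal x X ⊓ memVal y X ⇨
    (leVal R x y ⊓ leVal R y x ⇨ eqVal x y))

/-- `⟦s` is the least upper bound of `S` in `(X, R)⟧`. -/
def isLubVal (X R S s : BName B) : B :=
  memVal s X ⊓ (⨅ x : BName B, memVal x S ⇨ leVal R x s) ⊓
    (⨅ t : BName B, memVal t X ⇨ ((⨅ x : BName B, memVal x S ⇨ leVal R x t) ⇨ leVal R s t))

/-- `⟦m = x ⊓ y` in `(X, R)⟧`. -/
def isMeetVal (X R x y m : BName B) : B :=
  memVal m X ⊓ leVal R m x ⊓ leVal R m y ⊓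
    (⨅ t : BName B, memVal t X ⇨ (leVal R t x ⊓ leVal R t y ⇨ leVal R t m))

/-- `⟦j = x ⊔ y` in `(X, R)⟧`. -/
def isJoinVal (X R x y j : BName B) : B :=
  memVal j X ⊓ leVal R x j ⊓ leVal R y j ⊓
    (⨅ t : BName B, memVal t X ⇨ (leVal R x t ⊓ leVal R y t ⇨ leVal R j t))

/-- `⟦z` is the least element of `(X, R)⟧`. -/
def isBotVal (X R z : BName B) : B :=
  memVal z X ⊓ (⨅ x : BName B, memVal x X ⇨ leVal R z x)

/-- `⟦z` is the greatest element of `(X, R)⟧`. -/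
def isTopVal (X R z : BName B) : B :=
  memVal z X ⊓ (⨅ x : BName B, memVal x X ⇨ leVal R x z)

/-- `⟦x ⊓ (y ⊔ z) = (x ⊓ y) ⊔ (x ⊓ z)` holds in `(X, R)⟧`. -/
def isDistribVal (X R : BName B) : B :=
  ⨅ x : BName B, ⨅ y : BName B, ⨅ z : BName B, memVal x X ⊓ memVal y X ⊓ memVal z X ⇨
    ⨅ j : BName B, ⨅ m : BName B, ⨅ k : BName B, ⨅ l : BName B,
      isJoinVal X R y z j ⊓ isMeetVal X R x j m ⊓ isMeetVal X R x y k ⊓ isMeetVal X R x z l ⇨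
        isJoinVal X R k l m

/-- `⟦(X, R)` is complemented⟧`. -/
def isComplementedVal (X R : BName B) : B :=
  ⨅ x : BName B, memVal x X ⇨
    ⨆ y : BName B, ⨆ z : BName B, ⨆ t : BName B, memVal y X ⊓ isBotVal X R z ⊓
      isTopVal X R t ⊓ isMeetVal X R x y z ⊓ isJoinVal X R x y t

/-- `⟦(X, R)` is a complete Boolean algebra with `0 ≠ 1⟧`. -/
def isCompleteBooleanAlgebraVal (X R : BName B) : B :=
  isPartialOrderVal X R ⊓
  (⨅ S : BName B, subsetVal S X ⇨ ⨆ s : BName B, isLubVal X R S s) ⊓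
  isDistribVal X R ⊓ isComplementedVal X R ⊓
  (⨅ z : BName B, isBotVal X R z ⇨ (isTopVal X R z)ᶜ)

/-- `⟦`every element of `(X, R)` is `0` or `1⟧`. -/
def isTwoElementVal (X R : BName B) : B :=
  ⨅ x : BName B, memVal x X ⇨ isBotVal X R x ⊔ isTopVal X R x

/-- A class `Γ` of complete Boolean algebras is given by a formula `γ` with a set parameter `a`;
this is the Boolean value `⟦(X, R) ∈ Γ⟧` in `V^B`, where `Γ` is interpreted in `V^B`. -/
noncomputable def classVal (γ : setLanguage.Formula (Fin 3)) (a : ZFSet.{u}) (X R : BName B) : B :=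
  isCompleteBooleanAlgebraVal X R ⊓ truth γ ![check B a, X, R] ![]

end BName

/-! ### The regular open completion of a poset -/

/-- The complete Boolean algebra of regular open subsets of `P`, where the open sets are the
lower sets. -/
def RegularOpen (P : Type u) [Preorder P] : Type u := Heyting.Regular (LowerSet P)

noncomputable instance regularOpenBooleanAlgebra (P : Type u) [Preorder P] :
    BooleanAlgebra (RegularOpen P) :=
  inferInstanceAs (BooleanAlgebra (Heyting.Regular (LowerSet P)))

noncomputable instance regularOpenCBA (P : Type u) [Preorder P] :
    CompleteBooleanAlgebra (RegularOpen P) :=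
  let L : CompleteLattice (Heyting.Regular (LowerSet P)) :=
    (Heyting.Regular.gi (α := LowerSet P)).liftCompleteLattice
  { regularOpenBooleanAlgebra P with
    sSup := L.sSup
    sInf := L.sInf
    isLUB_sSup := L.isLUB_sSup
    isGLB_sInf := L.isGLB_sInf }

/-! ### Two-step iterations -/

/-- The two-step iteration `(B ↾ b) ∗ (X, R)` of a complete Boolean algebra `B` below a condition
`b` forcing `(X, R)` to be a complete Boolean algebra. Conditions are pairs `(p, ẋ)` with
`0 ≠ p ≤ b` in `B`, `ẋ` in the domain of `X`, and `p ⊩ ẋ ∈ X ∧ ẋ ≠ 0`. -/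
structure Iteration {B : Type u} [CompleteBooleanAlgebra B] (X R : BName B) (b : B) : Type u where
  /-- The first coordinate. -/
  fst : B
  /-- The (index of the) second coordinate. -/
  snd : X.Index
  fst_ne_bot : fst ≠ ⊥
  fst_le : fst ≤ b
  forces_mem : fst ≤ BName.memVal (X.elt snd) X
  forces_ne_zero : fst ≤ (BName.isBotVal X R (X.elt snd))ᶜ

/-- The order of the two-step iteration: `(p, ẋ) ≤ (q, ẏ)` iff `p ≤ q` and `p ⊩ ẋ ≤ ẏ`. -/
instance iterationPreorder {B : Type u} [CompleteBooleanAlgebra B] (X R : BName B) (b : B)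
    [hb : Fact (b ≤ BName.isCompleteBooleanAlgebraVal X R)] : Preorder (Iteration X R b) where
  le p q := p.fst ≤ q.fst ∧ p.fst ≤ BName.leVal R (X.elt p.snd) (X.elt q.snd)
  le_refl p := by
    refine ⟨le_rfl, ?_⟩
    have h : p.fst ≤ BName.memVal (X.elt p.snd) X ⇨ BName.leVal R (X.elt p.snd) (X.elt p.snd) :=
      (p.fst_le.trans hb.out).trans <|
        inf_le_left.trans <| inf_le_left.trans <| inf_le_left.trans <| inf_le_left.trans <|
        inf_le_left.trans <| inf_le_left.trans <| inf_le_right.trans <| iInf_le _ _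
    exact (le_inf le_rfl p.forces_mem).trans (le_himp_iff.1 h)
  le_trans p q r hpq hqr := by
    refine ⟨hpq.1.trans hqr.1, ?_⟩
    have h := (p.fst_le.trans hb.out).trans <|
        inf_le_left.trans <| inf_le_left.trans <| inf_le_left.trans <| inf_le_left.trans <|
        inf_le_left.trans <| inf_le_right.trans <| (iInf_le _ (X.elt p.snd)).trans <|
        (iInf_le _ (X.elt q.snd)).trans <| iInf_le _ (X.elt r.snd)
    have h1 := (le_inf le_rfl (le_inf (le_inf p.forces_mem (hpq.1.trans q.forces_mem))
      (hpq.1.trans (hqr.1.trans r.forces_mem)))).trans (le_himp_iff.1 h)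
    exact (le_inf le_rfl (le_inf hpq.2 (hpq.1.trans hqr.2))).trans (le_himp_iff.1 h1)

instance classVal_fact {B : Type u} [CompleteBooleanAlgebra B]
    (γ : setLanguage.Formula (Fin 3)) (a : ZFSet.{u}) (X R : BName B) :
    Fact (BName.classVal γ a X R ≤ BName.isCompleteBooleanAlgebraVal X R) :=
  ⟨inf_le_left⟩

/-! ### Classes of complete Boolean algebras, bounded forcing axioms, maximality principles -/

/-- The pair of sets `(X, R)` is, up to an isomorphism with the complete Boolean algebra `B`, a
complete Boolean algebra of the universe `V`: `X` is its underlying set and `R` its order. -/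
def Codes (X R : ZFSet.{u}) (B : Type u) [CompleteBooleanAlgebra B] : Prop :=
  ∃ e : B → ZFSet.{u}, Function.Injective e ∧ (∀ z, z ∈ X ↔ ∃ p, z = e p) ∧
    ∀ z, z ∈ R ↔ ∃ p q, p ≤ q ∧ z = ZFSet.pair (e p) (e q)

/-- `(X, R) ∈ Γ` in `V`, where `Γ` is the class of all complete Boolean algebras (with `0 ≠ 1`)
satisfying the formula `γ` with parameter `a`, and `(X, R)` is identified with `B`. -/
def InClass (γ : setLanguage.Formula (Fin 3)) (a X R : ZFSet.{u})
    (B : Type u) [CompleteBooleanAlgebra B] : Prop :=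
  Codes X R B ∧ Nontrivial B ∧ γ.Realize ![a, X, R]

/-- `Γ` contains the two-element complete Boolean algebra in `V^B`, for every `B ∈ Γ`. -/
def ContainsTrivial (γ : setLanguage.Formula (Fin 3)) (a : ZFSet.{u}) : Prop :=
  ∀ (X R : ZFSet.{u}) (B : Type u) [CompleteBooleanAlgebra B], InClass γ a X R B →
    (⨆ Y : BName B, ⨆ S : BName B,
      BName.classVal γ a Y S ⊓ BName.isTwoElementVal Y S) = (⊤ : B)

/-- Maximal antichains of a Boolean algebra, in the sense of forcing. -/
def IsMaximalAntichain {B : Type u} [CompleteBooleanAlgebra B] (D : Set B) : Prop :=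
  (∀ p ∈ D, p ≠ ⊥) ∧ (∀ p ∈ D, ∀ q ∈ D, p ≠ q → p ⊓ q = ⊥) ∧ ∀ p, p ≠ ⊥ → ∃ q ∈ D, p ⊓ q ≠ ⊥

/-- The bounded forcing axiom `FA_κ(Γ)`. -/
def BoundedForcingAxiom (κ : Cardinal.{u}) (γ : setLanguage.Formula (Fin 3)) (a : ZFSet.{u}) :
    Prop :=
  ∀ (X R : ZFSet.{u}) (B : Type u) [CompleteBooleanAlgebra B], InClass γ a X R B →
    ∀ D : Set.Iio (Ordinal.omega.{0} 1) → Set B,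
      (∀ ξ, IsMaximalAntichain (D ξ) ∧ Cardinal.mk (D ξ) ≤ κ) →
        ∃ G : Order.PFilter B, ⊥ ∉ G ∧ ∀ ξ, ∃ p ∈ D ξ, p ∈ G

/-- `V^B ⊨ "φ(Ǎ) is Γ-necessary"`: whenever `(X, R)` names a member of `Γ` as interpreted in
`V^B`, the formula `φ(Ǎ)` holds in the extension by `B ∗ (X, R)`. Here `(X, R)` is an arbitrary
pair of names, and the iteration is taken below `⟦(X, R) ∈ Γ⟧`. -/
def IsNecessaryOver (B : Type u) [CompleteBooleanAlgebra B] (γ : setLanguage.Formula (Fin 3))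
    (a : ZFSet.{u}) (φ : setLanguage.Formula (Fin 1)) (A : ZFSet.{u}) : Prop :=
  ∀ X R : BName B,
    BName.truth (B := RegularOpen (Iteration X R (BName.classVal γ a X R))) φ
      ![BName.check _ A] ![] = ⊤

/-- The maximality principle `MP_{Σ₁}(κ, Γ)`, where `κ` is an (initial) ordinal. -/
def MaximalityPrincipleSigma1 (κ : Ordinal.{u}) (γ : setLanguage.Formula (Fin 3))
    (a : ZFSet.{u}) : Prop :=
  ∀ φ : setLanguage.Formula (Fin 1), IsSigma1 φ → ∀ A : ZFSet.{u}, A ⊆ κ.toZFSet →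
    (∃ (X R : ZFSet.{u}) (B : Type u) (_ : CompleteBooleanAlgebra B),
      InClass γ a X R B ∧ IsNecessaryOver B γ a φ A) →
    φ.Realize ![A]

/-!
Both implications are proved with Boolean-valued models; generic extensions are not used.

From the forcing axiom to the maximality principle. Let `φ(A)` be `Γ`-necessary over `V^B`. By the
maximum principle there is a name for a two-element algebra in `Γ`, and iterating `B` with it gives
an algebra isomorphic to `B` (`Iteration.nonempty_orderIso`), so `φ(A)` has Boolean value `1` in
an algebra satisfying the forcing axiom. Bagaria's theorem that the bounded forcing axiom implies
`Σ₁` absoluteness then applies (`realize_of_truth_eq_top`): close the parameters under witnesses to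
a family of `ℵ₁` many names (`BName.exists_closed_family`), take a filter that decides all formulas
about these names and respects `ℵ₁` many suprema of size `ℵ₁`, and collapse the structure that the
filter defines. Two kinds of suprema matter. Those for membership in canonical names make the
collapse fix `A`. Those for Boolean-valued ranks make the structure well-founded
(`wellFounded_of_rank`): a descending sequence lies in a countable subfamily of the names, and the
rank of a member of a countable family cannot be forced to be uncountable by a filter that
respects the relevant suprema (`compl_iSup_rankEq_le`), because then each countable ordinal would
be the rank of a member of the countable family. The collapsed structure is a transitive set in
which `φ(A)` holds, and `Σ₁` formulas are upward absolute.

From the maximality principle to the forcing axiom. The task is to code `ℵ₁` many maximal antichains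
of `B` into a subset `A` of `ω₁` such that the existence of a filter meeting them is `Σ₁` in `A`.
Consider finite meets of members of the antichains. They are arranged in columns: column `ξ` lists
the meets of selections from the `ξ`-th finite set of antichains, so that its supremum is `1`
(`iSup_approx_eq_top`). A choice of pairwise compatible conditions, one from each column, generates
a filter meeting all the antichains, because selections from the same antichains are equal or
incompatible (`approx_le_approx`, `exists_approximation_matrix`). The `i`-th entry of column `ξ` gets
the index `c ξ i`, where `c` is a pairing function on `ω₁`, and `A` is the set of all `c γ δ` for
which the conditions with indices `γ` and `δ` are compatible. Since `ω₁` is the union of `A` and `c`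
has a `Δ₀` description over `ω₁` (`IsPairCoding.eq_code`), a `Σ₁` formula can say that some set `g`
of indices meets all the columns and consists of pairwise compatible indices. The witnesses other
than `g` exist already in the ground model, and the canonical name of the generic filter of `B`
names a suitable `g`. This name has the same property in all further extensions
(`isNecessaryOver_existsPathFormula`), so the formula is `Γ`-necessary over `V^B` and holds in `V`.
-/

/-! ### Congruence of Boolean values modulo a condition -/

/-- The Boolean values `a` and `b` agree below the condition `e`. This congruence is compatible
with all Boolean operations, including infinitary ones. -/
def Cong {B : Type*} [CompleteBooleanAlgebra B] (e a b : B) : Prop := e ⊓ a = e ⊓ b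

namespace Cong

variable {B : Type*} [CompleteBooleanAlgebra B] {e a b c d : B}

protected theorem rfl : Cong e a a := Eq.refl _

protected theorem symm (h : Cong e a b) : Cong e b a := Eq.symm h

protected theorem le (h : Cong e a b) : e ⊓ a ≤ b := (le_of_eq h).trans inf_le_right

theorem of_le (h : e ⊓ a ≤ b) (h' : e ⊓ b ≤ a) : Cong e a b :=
  le_antisymm (le_inf inf_le_left h) (le_inf inf_le_left h')

theorem eq_of_top (h : Cong ⊤ a b) : a = b := by simpa [Cong] using h

protected theorem inf (h : Cong e a b) (h' : Cong e c d) : Cong e (a ⊓ c) (b ⊓ d) := by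
  unfold Cong at *
  rw [inf_inf_distrib_left, h, h', ← inf_inf_distrib_left]

protected theorem sup (h : Cong e a b) (h' : Cong e c d) : Cong e (a ⊔ c) (b ⊔ d) := by
  unfold Cong at *
  rw [inf_sup_left, h, h', ← inf_sup_left]

protected theorem himp (h : Cong e a b) (h' : Cong e c d) : Cong e (a ⇨ c) (b ⇨ d) := by
  have key : ∀ {a b c d : B}, Cong e a b → Cong e c d → e ⊓ (a ⇨ c) ≤ b ⇨ d := by
    intro a b c d h h'
    rw [le_himp_iff]
    calc e ⊓ (a ⇨ c) ⊓ b = (e ⊓ b) ⊓ (a ⇨ c) := by ac_rfl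
      _ = e ⊓ (a ⊓ (a ⇨ c)) := by rw [← h, inf_assoc]
      _ ≤ e ⊓ c := inf_le_inf_left _ (by simp)
      _ ≤ d := h'.le
  exact of_le (key h h') (key h.symm h'.symm)

protected theorem compl (h : Cong e a b) : Cong e aᶜ bᶜ := by
  rw [← himp_bot, ← himp_bot]
  exact h.himp Cong.rfl

protected theorem iSup {ι : Sort*} {f g : ι → B} (h : ∀ i, Cong e (f i) (g i)) :
    Cong e (⨆ i, f i) (⨆ i, g i) := by
  unfold Cong at *
  rw [inf_iSup_eq, inf_iSup_eq]
  exact iSup_congr h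

protected theorem iInf {ι : Sort*} {f g : ι → B} (h : ∀ i, Cong e (f i) (g i)) :
    Cong e (⨅ i, f i) (⨅ i, g i) :=
  of_le (le_iInf fun i => (inf_le_inf_left e (iInf_le _ i)).trans (h i).le)
    (le_iInf fun i => (inf_le_inf_left e (iInf_le _ i)).trans (h i).symm.le)

end Cong

/-- A family in a complete Boolean algebra that is indexed by a well-ordered type can be shrunk
to a disjoint family with the same supremum. -/
theorem exists_disjointed {B : Type*} [CompleteBooleanAlgebra B] {ι : Type*} [LinearOrder ι]
    [WellFoundedLT ι] (b : ι → B) :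
    ∃ a : ι → B, (∀ i, a i ≤ b i) ∧ (∀ i j, i ≠ j → a i ⊓ a j = ⊥) ∧ ⨆ i, a i = ⨆ i, b i := by
  refine ⟨fun i => b i \ ⨆ j : {j // j < i}, b j, fun i => sdiff_le, ?_, ?_⟩
  · have key : ∀ i j, i < j →
        (b i \ ⨆ k : {k // k < i}, b k) ⊓ (b j \ ⨆ k : {k // k < j}, b k) = ⊥ := by
      intro i j h
      refine le_bot_iff.1 ((inf_le_inf_right _ (sdiff_le.trans
        (le_iSup (fun k : {k // k < j} => b k) ⟨i, h⟩))).trans ?_)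
      rw [inf_sdiff_self_right]
    intro i j h
    rcases lt_or_gt_of_ne h with h | h
    · exact key i j h
    · rw [inf_comm]
      exact key j i h
  · refine le_antisymm (iSup_mono fun i => sdiff_le) (iSup_le fun i => ?_)
    induction i using WellFoundedLT.induction with
    | ind i ih =>
      refine (le_sdiff_sup (b := b i) (a := ⨆ k : {k // k < i}, b k)).trans (sup_le ?_ ?_)
      · exact le_iSup (fun i => b i \ ⨆ k : {k // k < i}, b k) i
      · exact iSup_le fun k => ih k k.2

theorem setLanguage_term_eq_var {β : Type} (t : setLanguage.Term β) : ∃ i, t = Term.var i := by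
  cases t with
  | var i => exact ⟨i, rfl⟩
  | func f _ => exact Empty.elim f

namespace BName

variable {B : Type u} [CompleteBooleanAlgebra B]

/-! ### Equality and membership in `V^B` -/

theorem eqVal_def (x y : BName B) : eqVal x y =
    (⨅ i, x.val i ⇨ ⨆ j, y.val j ⊓ eqVal (x.elt i) (y.elt j)) ⊓
      (⨅ j, y.val j ⇨ ⨆ i, x.val i ⊓ eqVal (x.elt i) (y.elt j)) := by
  cases x; cases y; rw [eqVal]; rfl

theorem eqVal_refl (x : BName B) : eqVal x x = ⊤ := by
  induction x with
  | mk ι x v ih =>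
    rw [eqVal_def]
    refine top_le_iff.1 (le_inf ?_ ?_)
    all_goals
      refine le_iInf fun i => le_himp_iff.2 ?_
      exact le_iSup_of_le i (le_inf inf_le_right (le_top.trans_eq (ih i).symm))

theorem eqVal_symm (x y : BName B) : eqVal x y = eqVal y x := by
  induction x generalizing y with
  | mk ι x v ih =>
    cases y with
    | mk κ y w =>
      have h : ∀ i j, eqVal (x i) (y j) = eqVal (y j) (x i) := fun i j => ih i (y j)
      rw [eqVal_def, eqVal_def, inf_comm]
      change (⨅ j, w j ⇨ ⨆ i, v i ⊓ eqVal (x i) (y j)) ⊓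
        (⨅ i, v i ⇨ ⨆ j, w j ⊓ eqVal (x i) (y j)) = _
      simp only [h]
      rfl

theorem val_inf_eqVal_le (x y : BName B) (i : x.Index) :
    x.val i ⊓ eqVal x y ≤ ⨆ j, y.val j ⊓ eqVal (x.elt i) (y.elt j) := by
  rw [eqVal_def, ← le_himp_iff']
  exact inf_le_left.trans (iInf_le _ i)

theorem val_inf_eqVal_le' (x y : BName B) (j : y.Index) :
    y.val j ⊓ eqVal x y ≤ ⨆ i, x.val i ⊓ eqVal (x.elt i) (y.elt j) := by
  rw [eqVal_def, ← le_himp_iff']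
  exact inf_le_right.trans (iInf_le _ j)

theorem eqVal_trans (x y z : BName B) : eqVal x y ⊓ eqVal y z ≤ eqVal x z := by
  induction x generalizing y z with
  | mk ι xe v ih =>
    set x := mk ι xe v
    rw [eqVal_def x z]
    refine le_inf (le_iInf fun i => ?_) (le_iInf fun k => ?_)
    · rw [le_himp_iff]
      calc eqVal x y ⊓ eqVal y z ⊓ x.val i = (x.val i ⊓ eqVal x y) ⊓ eqVal y z := by ac_rfl
        _ ≤ (⨆ j, y.val j ⊓ eqVal (x.elt i) (y.elt j)) ⊓ eqVal y z :=
          inf_le_inf_right _ (val_inf_eqVal_le x y i)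
        _ ≤ _ := by
          rw [iSup_inf_eq]
          refine iSup_le fun j => ?_
          calc y.val j ⊓ eqVal (x.elt i) (y.elt j) ⊓ eqVal y z
              = (y.val j ⊓ eqVal y z) ⊓ eqVal (x.elt i) (y.elt j) := by ac_rfl
            _ ≤ (⨆ k, z.val k ⊓ eqVal (y.elt j) (z.elt k)) ⊓ eqVal (x.elt i) (y.elt j) :=
              inf_le_inf_right _ (val_inf_eqVal_le y z j)
            _ ≤ _ := by
              rw [iSup_inf_eq]
              refine iSup_mono fun k => ?_
              rw [inf_assoc, inf_comm (eqVal (y.elt j) _)]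
              exact inf_le_inf_left _ (ih i _ _)
    · rw [le_himp_iff]
      calc eqVal x y ⊓ eqVal y z ⊓ z.val k = (z.val k ⊓ eqVal y z) ⊓ eqVal x y := by ac_rfl
        _ ≤ (⨆ j, y.val j ⊓ eqVal (y.elt j) (z.elt k)) ⊓ eqVal x y :=
          inf_le_inf_right _ (val_inf_eqVal_le' y z k)
        _ ≤ _ := by
          rw [iSup_inf_eq]
          refine iSup_le fun j => ?_
          calc y.val j ⊓ eqVal (y.elt j) (z.elt k) ⊓ eqVal x y
              = (y.val j ⊓ eqVal x y) ⊓ eqVal (y.elt j) (z.elt k) := by ac_rfl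
            _ ≤ (⨆ i, x.val i ⊓ eqVal (x.elt i) (y.elt j)) ⊓ eqVal (y.elt j) (z.elt k) :=
              inf_le_inf_right _ (val_inf_eqVal_le' x y j)
            _ ≤ _ := by
              rw [iSup_inf_eq]
              refine iSup_mono fun i => ?_
              rw [inf_assoc]
              exact inf_le_inf_left _ (ih i _ _)

theorem val_le_memVal (x : BName B) (i : x.Index) : x.val i ≤ memVal (x.elt i) x :=
  le_iSup_of_le i (by rw [eqVal_refl, inf_top_eq])

theorem eqVal_inf_memVal_le_left (x x' y : BName B) :
    eqVal x x' ⊓ memVal x y ≤ memVal x' y := by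
  unfold memVal
  rw [inf_iSup_eq]
  refine iSup_mono fun j => ?_
  rw [inf_left_comm, eqVal_symm x x']
  exact inf_le_inf_left _ (eqVal_trans _ _ _)

theorem eqVal_inf_memVal_le_right (x y y' : BName B) :
    eqVal y y' ⊓ memVal x y ≤ memVal x y' := by
  conv_lhs => unfold memVal
  rw [inf_iSup_eq]
  refine iSup_le fun j => ?_
  calc eqVal y y' ⊓ (y.val j ⊓ eqVal x (y.elt j))
      = (y.val j ⊓ eqVal y y') ⊓ eqVal x (y.elt j) := by ac_rfl
    _ ≤ (⨆ k, y'.val k ⊓ eqVal (y.elt j) (y'.elt k)) ⊓ eqVal x (y.elt j) :=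
      inf_le_inf_right _ (val_inf_eqVal_le y y' j)
    _ ≤ memVal x y' := by
      rw [iSup_inf_eq]
      refine iSup_mono fun k => ?_
      rw [inf_assoc, inf_comm (eqVal (y.elt j) _)]
      exact inf_le_inf_left _ (eqVal_trans _ _ _)

section Congruence

variable {e : B} {x x' y y' z z' X X' R R' S S' : BName B}

theorem eqVal_cong (hx : e ≤ eqVal x x') (hy : e ≤ eqVal y y') :
    Cong e (eqVal x y) (eqVal x' y') := by
  have key : ∀ {x x' y y' : BName B}, e ≤ eqVal x x' → e ≤ eqVal y y' →
      e ⊓ eqVal x y ≤ eqVal x' y' := by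
    intro x x' y y' hx hy
    rw [eqVal_symm x x'] at hx
    calc e ⊓ eqVal x y ≤ eqVal x' x ⊓ eqVal x y ⊓ eqVal y y' :=
          le_inf (inf_le_inf_right _ hx) (inf_le_left.trans hy)
      _ ≤ eqVal x' y ⊓ eqVal y y' := inf_le_inf_right _ (eqVal_trans _ _ _)
      _ ≤ _ := eqVal_trans _ _ _
  exact Cong.of_le (key hx hy) (key (by rwa [eqVal_symm]) (by rwa [eqVal_symm]))

theorem memVal_cong (hx : e ≤ eqVal x x') (hy : e ≤ eqVal y y') :
    Cong e (memVal x y) (memVal x' y') := by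
  have key : ∀ {x x' y y' : BName B}, e ≤ eqVal x x' → e ≤ eqVal y y' →
      e ⊓ memVal x y ≤ memVal x' y' := by
    intro x x' y y' hx hy
    calc e ⊓ memVal x y ≤ eqVal y y' ⊓ (eqVal x x' ⊓ memVal x y) :=
          le_inf (inf_le_left.trans hy) (inf_le_inf_right _ hx)
      _ ≤ eqVal y y' ⊓ memVal x' y := inf_le_inf_left _ (eqVal_inf_memVal_le_left _ _ _)
      _ ≤ _ := eqVal_inf_memVal_le_right _ _ _
  exact Cong.of_le (key hx hy) (key (by rwa [eqVal_symm]) (by rwa [eqVal_symm]))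

theorem le_eqVal_upair (hx : e ≤ eqVal x x') (hy : e ≤ eqVal y y') :
    e ≤ eqVal (upair x y) (upair x' y') := by
  rw [eqVal_def]
  refine le_inf (le_iInf fun i => le_himp_iff.2 ?_) (le_iInf fun i => le_himp_iff.2 ?_)
  all_goals
    refine le_iSup_of_le i (le_inf le_top (inf_le_left.trans ?_))
    rcases i with ⟨_ | _⟩
    · exact hy
    · exact hx

theorem le_eqVal_opair (hx : e ≤ eqVal x x') (hy : e ≤ eqVal y y') :
    e ≤ eqVal (opair x y) (opair x' y') :=
  le_eqVal_upair (le_eqVal_upair hx hx) (le_eqVal_upair hx hy)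

theorem le_eqVal_refl (e : B) (x : BName B) : e ≤ eqVal x x := by
  rw [eqVal_refl]; exact le_top

theorem leVal_cong (hR : e ≤ eqVal R R') (hx : e ≤ eqVal x x') (hy : e ≤ eqVal y y') :
    Cong e (leVal R x y) (leVal R' x' y') :=
  memVal_cong (le_eqVal_opair hx hy) hR

theorem subsetVal_cong (hS : e ≤ eqVal S S') (hX : e ≤ eqVal X X') :
    Cong e (subsetVal S X) (subsetVal S' X') :=
  Cong.iInf fun t =>
    (memVal_cong (le_eqVal_refl e t) hS).himp (memVal_cong (le_eqVal_refl e t) hX)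

theorem isBotVal_cong (hX : e ≤ eqVal X X') (hR : e ≤ eqVal R R') (hz : e ≤ eqVal z z') :
    Cong e (isBotVal X R z) (isBotVal X' R' z') :=
  (memVal_cong hz hX).inf <| Cong.iInf fun t =>
    (memVal_cong (le_eqVal_refl e t) hX).himp (leVal_cong hR hz (le_eqVal_refl e t))

theorem isTopVal_cong (hX : e ≤ eqVal X X') (hR : e ≤ eqVal R R') (hz : e ≤ eqVal z z') :
    Cong e (isTopVal X R z) (isTopVal X' R' z') :=
  (memVal_cong hz hX).inf <| Cong.iInf fun t =>
    (memVal_cong (le_eqVal_refl e t) hX).himp (leVal_cong hR (le_eqVal_refl e t) hz)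

theorem isTwoElementVal_cong (hX : e ≤ eqVal X X') (hR : e ≤ eqVal R R') :
    Cong e (isTwoElementVal X R) (isTwoElementVal X' R') :=
  Cong.iInf fun t => (memVal_cong (le_eqVal_refl e t) hX).himp
    ((isBotVal_cong hX hR (le_eqVal_refl e t)).sup (isTopVal_cong hX hR (le_eqVal_refl e t)))

theorem isPartialOrderVal_cong (hX : e ≤ eqVal X X') (hR : e ≤ eqVal R R') :
    Cong e (isPartialOrderVal X R) (isPartialOrderVal X' R') := by
  have hm : ∀ t, Cong e (memVal t X) (memVal t X') := fun t => memVal_cong (le_eqVal_refl e t) hX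
  have hmR : ∀ t, Cong e (memVal t R) (memVal t R') := fun t => memVal_cong (le_eqVal_refl e t) hR
  have hl : ∀ s t, Cong e (leVal R s t) (leVal R' s t) := fun s t =>
    leVal_cong hR (le_eqVal_refl e s) (le_eqVal_refl e t)
  refine Cong.inf (Cong.inf (Cong.inf ?_ ?_) ?_) ?_
  · exact Cong.iInf fun z => (hmR z).himp <| Cong.iSup fun x => Cong.iSup fun y =>
      ((hm x).inf (hm y)).inf Cong.rfl
  · exact Cong.iInf fun x => (hm x).himp (hl x x)
  · exact Cong.iInf fun x => Cong.iInf fun y => Cong.iInf fun z =>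
      (((hm x).inf (hm y)).inf (hm z)).himp (((hl x y).inf (hl y z)).himp (hl x z))
  · exact Cong.iInf fun x => Cong.iInf fun y =>
      ((hm x).inf (hm y)).himp (((hl x y).inf (hl y x)).himp Cong.rfl)

theorem isCompleteBooleanAlgebraVal_cong (hX : e ≤ eqVal X X') (hR : e ≤ eqVal R R') :
    Cong e (isCompleteBooleanAlgebraVal X R) (isCompleteBooleanAlgebraVal X' R') := by
  have hm : ∀ t, Cong e (memVal t X) (memVal t X') := fun t => memVal_cong (le_eqVal_refl e t) hX
  have hl : ∀ s t, Cong e (leVal R s t) (leVal R' s t) := fun s t =>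
    leVal_cong hR (le_eqVal_refl e s) (le_eqVal_refl e t)
  have hbot : ∀ t, Cong e (isBotVal X R t) (isBotVal X' R' t) := fun t =>
    isBotVal_cong hX hR (le_eqVal_refl e t)
  have htop : ∀ t, Cong e (isTopVal X R t) (isTopVal X' R' t) := fun t =>
    isTopVal_cong hX hR (le_eqVal_refl e t)
  have hmeet : ∀ x y m, Cong e (isMeetVal X R x y m) (isMeetVal X' R' x y m) := fun x y m =>
    (((hm m).inf (hl m x)).inf (hl m y)).inf <| Cong.iInf fun t =>
      (hm t).himp (((hl t x).inf (hl t y)).himp (hl t m))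
  have hjoin : ∀ x y m, Cong e (isJoinVal X R x y m) (isJoinVal X' R' x y m) := fun x y m =>
    (((hm m).inf (hl x m)).inf (hl y m)).inf <| Cong.iInf fun t =>
      (hm t).himp (((hl x t).inf (hl y t)).himp (hl m t))
  refine Cong.inf (Cong.inf (Cong.inf (Cong.inf (isPartialOrderVal_cong hX hR) ?_) ?_) ?_) ?_
  · exact Cong.iInf fun S => (subsetVal_cong (le_eqVal_refl e S) hX).himp <| Cong.iSup fun s =>
      ((hm s).inf (Cong.iInf fun x => Cong.rfl.himp (hl x s))).inf <| Cong.iInf fun t =>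
        (hm t).himp ((Cong.iInf fun x => Cong.rfl.himp (hl x t)).himp (hl s t))
  · exact Cong.iInf fun x => Cong.iInf fun y => Cong.iInf fun z =>
      (((hm x).inf (hm y)).inf (hm z)).himp <|
        Cong.iInf fun j => Cong.iInf fun m => Cong.iInf fun k => Cong.iInf fun l =>
          ((((hjoin y z j).inf (hmeet x j m)).inf (hmeet x y k)).inf (hmeet x z l)).himp
            (hjoin k l m)
  · exact Cong.iInf fun x => (hm x).himp <|
      Cong.iSup fun y => Cong.iSup fun z => Cong.iSup fun t =>
        ((((hm y).inf (hbot z)).inf (htop t)).inf (hmeet x y z)).inf (hjoin x y t)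
  · exact Cong.iInf fun z => (hbot z).himp (htop z).compl

theorem truth_cong {α : Type} {n : ℕ} (φ : setLanguage.BoundedFormula α n)
    {v v' : α → BName B} {xs xs' : Fin n → BName B} (hv : ∀ i, e ≤ eqVal (v i) (v' i))
    (hxs : ∀ i, e ≤ eqVal (xs i) (xs' i)) : Cong e (truth φ v xs) (truth φ v' xs') := by
  induction φ with
  | falsum => exact Cong.rfl
  | @equal n s t =>
    obtain ⟨i, rfl⟩ := setLanguage_term_eq_var s
    obtain ⟨j, rfl⟩ := setLanguage_term_eq_var t
    exact eqVal_cong (by cases i; exacts [hv _, hxs _]) (by cases j; exacts [hv _, hxs _])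
  | @rel n k r ts =>
    cases r with
    | mem =>
      obtain ⟨i, hi⟩ := setLanguage_term_eq_var (ts 0)
      obtain ⟨j, hj⟩ := setLanguage_term_eq_var (ts 1)
      simp only [truth, hi, hj]
      exact memVal_cong (by cases i; exacts [hv _, hxs _]) (by cases j; exacts [hv _, hxs _])
  | imp φ ψ ih₁ ih₂ => exact (ih₁ hxs).himp (ih₂ hxs)
  | all φ ih =>
    refine Cong.iInf fun x => ih fun i => ?_
    refine Fin.lastCases ?_ (fun i => ?_) i
    · simp [le_eqVal_refl]
    · simpa using hxs i

theorem classVal_cong (γ : setLanguage.Formula (Fin 3)) (a : ZFSet.{u})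
    (hX : e ≤ eqVal X X') (hR : e ≤ eqVal R R') :
    Cong e (classVal γ a X R) (classVal γ a X' R') :=
  (isCompleteBooleanAlgebraVal_cong hX hR).inf <| truth_cong γ
    (fun i => by fin_cases i; exacts [le_eqVal_refl _ _, hX, hR]) (fun i => i.elim0)

end Congruence

/-! ### Mixing and the maximum principle -/

/-- The mixture of the names `x i` along the values `a i`. -/
def mixture {ι : Type u} (a : ι → B) (x : ι → BName B) : BName B :=
  mk (Σ i, (x i).Index) (fun p => (x p.1).elt p.2) (fun p => a p.1 ⊓ (x p.1).val p.2)

theorem le_eqVal_mixture {ι : Type u} (a : ι → B) (x : ι → BName B)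
    (ha : ∀ i j, i ≠ j → a i ⊓ a j = ⊥) (i : ι) : a i ≤ eqVal (mixture a x) (x i) := by
  rw [eqVal_def]
  refine le_inf (le_iInf fun p => le_himp_iff.2 ?_) (le_iInf fun j => le_himp_iff.2 ?_)
  · obtain ⟨k, j⟩ := p
    by_cases h : i = k
    · subst h
      refine le_iSup_of_le j (le_inf (inf_le_right.trans inf_le_right) ?_)
      exact le_eqVal_refl _ _
    · refine le_trans ?_ (bot_le)
      rw [← ha i k h]
      exact inf_le_inf_left _ inf_le_left
  · exact le_iSup_of_le (⟨i, j⟩ : Σ i, (x i).Index) (le_inf le_rfl (le_eqVal_refl _ _))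

/-- The maximum principle: an extensional `B`-valued predicate attains its supremum. -/
theorem exists_iSup_le (f : BName B → B) (hf : ∀ x y, eqVal x y ⊓ f x ≤ f y) :
    ∃ x, ⨆ y, f y ≤ f x := by
  classical
  -- The values of `f` form a set, so a set of names suffices.
  let ι : Type u := Set.range f
  choose x hx using fun i : ι => i.2
  obtain ⟨_, _⟩ := exists_wellFoundedLT ι
  obtain ⟨a, ha, hdisj, hsup⟩ := exists_disjointed (fun i : ι => (i : B))
  refine ⟨mixture a x, iSup_le fun y => ?_⟩
  have h1 : f y ≤ ⨆ i, a i := by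
    rw [hsup]
    exact le_iSup (fun i : ι => (i : B)) ⟨f y, y, rfl⟩
  refine h1.trans (iSup_le fun i => ?_)
  refine le_trans (le_inf ?_ ?_) (hf (x i) (mixture a x))
  · rw [eqVal_symm]
    exact le_eqVal_mixture a x hdisj i
  · rw [hx]
    exact ha i

/-! ### Canonical names -/

theorem checkPSet_equiv {x y : PSet.{u}} (h : x.Equiv y) :
    eqVal (checkPSet B x) (checkPSet B y) = ⊤ := by
  induction x generalizing y with
  | mk ι x ih =>
    cases y with
    | mk κ y =>
      rw [eqVal_def]
      refine top_le_iff.1 (le_inf (le_iInf fun i => le_himp_iff.2 ?_)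
        (le_iInf fun j => le_himp_iff.2 ?_))
      · obtain ⟨j, hj⟩ := h.1 i
        exact le_iSup_of_le j (le_inf le_top (le_top.trans_eq (ih i hj).symm))
      · obtain ⟨i, hi⟩ := h.2 j
        exact le_iSup_of_le i (le_inf le_top (le_top.trans_eq (ih i hi).symm))

theorem eqVal_check_mk (x : PSet.{u}) :
    eqVal (check B (ZFSet.mk x)) (checkPSet B x) = ⊤ :=
  checkPSet_equiv (ZFSet.exact (ZFSet.mk_out _))

theorem memVal_check (n : BName B) (x : ZFSet.{u}) :
    memVal n (check B x) = ⨆ y : {y // y ∈ x}, eqVal n (check B y) := by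
  obtain ⟨p, rfl⟩ : ∃ p, ZFSet.mk p = x := ⟨_, ZFSet.mk_out x⟩
  have h1 : memVal n (check B (ZFSet.mk p)) = memVal n (checkPSet B p) :=
    (memVal_cong (e := ⊤) (le_eqVal_refl _ n) (eqVal_check_mk p).ge).eq_of_top
  have h2 : ∀ q : PSet.{u}, eqVal n (checkPSet B q) = eqVal n (check B (ZFSet.mk q)) := fun q =>
    (eqVal_cong (e := ⊤) (le_eqVal_refl _ n) ((eqVal_symm _ _).trans (eqVal_check_mk q)).ge).eq_of_top
  rw [h1]
  cases p with
  | mk ι A =>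
    refine le_antisymm (iSup_le fun i => ?_) (iSup_le fun y => ?_)
    · refine le_iSup_of_le ⟨ZFSet.mk (A i), ZFSet.mk_mem_iff.2 (PSet.Mem.mk A i)⟩ ?_
      exact inf_le_right.trans_eq (h2 (A i))
    · obtain ⟨y, hy⟩ := y
      obtain ⟨q, rfl⟩ : ∃ p, ZFSet.mk p = y := ⟨_, ZFSet.mk_out y⟩
      obtain ⟨i, hi⟩ := ZFSet.mk_mem_iff.1 hy
      refine le_iSup_of_le i (le_inf le_top ?_)
      have h3 : ZFSet.mk q = ZFSet.mk (A i) := ZFSet.sound hi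
      exact le_of_eq ((congrArg (fun z => eqVal n (check B z)) h3).trans (h2 (A i)).symm)

theorem memVal_check_check {x y : ZFSet.{u}} (h : y ∈ x) :
    memVal (check B y) (check B x) = ⊤ := by
  rw [memVal_check]
  exact top_le_iff.1 (le_iSup_of_le ⟨y, h⟩ (eqVal_refl _).ge)

end BName

/-! ### The index set `ω₁` -/

/-- The ordinal `ω₁`, as a well-ordered type in the lowest universe. -/
abbrev OmegaOne : Type := (Ordinal.omega.{0} 1).ToType

namespace OmegaOne

open Cardinal

theorem mk_eq : #OmegaOne = aleph 1 := by
  rw [Cardinal.mk_toType, Ordinal.card_omega]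

instance : Uncountable OmegaOne := by
  rw [← aleph0_lt_mk_iff, mk_eq]
  exact aleph0_lt_aleph_one

theorem countable_Iio (i : OmegaOne) : (Iio i).Countable := by
  have h := Cardinal.lt_omega_iff_card_lt.1 (Ordinal.typein_lt_self i)
  rw [← Ordinal.type_Iio_lt, Ordinal.card_type] at h
  exact le_aleph0_iff_set_countable.1 (lt_aleph_one_iff.1 h)

theorem exists_gt_of_countable {s : Set OmegaOne} (hs : s.Countable) : ∃ δ, ∀ i ∈ s, i < δ := by
  by_contra! h
  have h1 : (⋃ i ∈ s, Iic i) = Set.univ :=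
    eq_univ_of_forall fun δ => by
      obtain ⟨i, hi, hle⟩ := h δ
      exact mem_biUnion hi hle
  have h2 : (⋃ i ∈ s, Iic i).Countable := hs.biUnion fun i _ => by
    rw [← Iio_union_right]
    exact (countable_Iio i).union (countable_singleton i)
  rw [h1] at h2
  exact not_countable_univ h2

/-- The von Neumann ordinal corresponding to an element of `ω₁`. -/
noncomputable def toZFSet (i : OmegaOne) : ZFSet.{u} :=
  (Ordinal.lift.{u} (i.toOrd : Ordinal.{0})).toZFSet

theorem toZFSet_mem_toZFSet {i j : OmegaOne} : toZFSet.{u} i ∈ toZFSet.{u} j ↔ i < j := by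
  rw [toZFSet, toZFSet, Ordinal.toZFSet_mem_toZFSet_iff, Ordinal.lift_lt, Subtype.coe_lt_coe,
    OrderIso.lt_iff_lt]

theorem toZFSet_injective : Function.Injective toZFSet.{u} := fun i j h => by
  rcases lt_trichotomy i j with hij | hij | hij
  · rw [← toZFSet_mem_toZFSet.{u}, h] at hij
    exact (ZFSet.mem_irrefl _ hij).elim
  · exact hij
  · rw [← toZFSet_mem_toZFSet.{u}, h] at hij
    exact (ZFSet.mem_irrefl _ hij).elim

theorem mem_toZFSet_omega {x : ZFSet.{u}} :
    x ∈ (Ordinal.omega.{u} 1).toZFSet ↔ ∃ i : OmegaOne, x = toZFSet i := by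
  rw [Ordinal.mem_toZFSet_iff]
  constructor
  · rintro ⟨a, ha, rfl⟩
    have h1 : Ordinal.lift.{u} (Ordinal.omega.{0} 1) = Ordinal.omega.{u} 1 := by simp
    rw [← h1] at ha
    obtain ⟨b, rfl⟩ := Ordinal.mem_range_lift_of_le ha.le
    exact ⟨Ordinal.ToType.mk ⟨b, Ordinal.lift_lt.1 ha⟩, by simp [toZFSet, Ordinal.ToType.toOrd]⟩
  · rintro ⟨i, rfl⟩
    refine ⟨_, ?_, rfl⟩
    have h := Ordinal.lift_lt.{u}.2 (Set.mem_Iio.1 i.toOrd.2)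
    simpa using h

theorem exists_mem_toZFSet_omega {p : ZFSet.{u} → Prop} :
    (∃ x ∈ (Ordinal.omega.{u} 1).toZFSet, p x) ↔ ∃ i : OmegaOne, p (toZFSet i) := by
  simp only [mem_toZFSet_omega]
  exact ⟨fun ⟨_, ⟨i, hi⟩, h⟩ => ⟨i, hi ▸ h⟩, fun ⟨i, h⟩ => ⟨_, ⟨i, rfl⟩, h⟩⟩

theorem forall_mem_toZFSet_omega {p : ZFSet.{u} → Prop} :
    (∀ x ∈ (Ordinal.omega.{u} 1).toZFSet, p x) ↔ ∀ i : OmegaOne, p (toZFSet i) := by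
  simp only [mem_toZFSet_omega, forall_exists_index, forall_eq_apply_imp_iff]

theorem mem_toZFSet {x : ZFSet.{u}} {j : OmegaOne} :
    x ∈ toZFSet.{u} j ↔ ∃ i < j, x = toZFSet i := by
  constructor
  · intro h
    have h2 : x ∈ (Ordinal.omega.{u} 1).toZFSet :=
      (ZFSet.isOrdinal_toZFSet _).mem_trans h (mem_toZFSet_omega.2 ⟨j, rfl⟩)
    obtain ⟨i, rfl⟩ := mem_toZFSet_omega.1 h2
    exact ⟨i, toZFSet_mem_toZFSet.1 h, rfl⟩
  · rintro ⟨i, h, rfl⟩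
    exact toZFSet_mem_toZFSet.2 h

end OmegaOne

/-! ### Filters respecting `ℵ₁` many suprema -/

/-- For any `ℵ₁` many suprema of families of size `ℵ₁`, there is a proper filter that decides
each of these suprema and, if it contains one of them, contains a member of the family. -/
def HasGenericFilters (B : Type u) [CompleteBooleanAlgebra B] : Prop :=
  ∀ {J : Type}, Cardinal.mk J ≤ Cardinal.aleph 1 → ∀ c : J → OmegaOne → B,
    ∃ G : Order.PFilter B, ⊥ ∉ G ∧ ∀ j, (∃ i, c j i ∈ G) ∨ (⨆ i, c j i)ᶜ ∈ G

theorem BoundedForcingAxiom.hasGenericFilters {γ : setLanguage.Formula (Fin 3)} {a : ZFSet.{u}}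
    (hFA : BoundedForcingAxiom (Cardinal.aleph 1) γ a) {X R : ZFSet.{u}} {B : Type u}
    [CompleteBooleanAlgebra B] (hB : InClass γ a X R B) : HasGenericFilters B := by
  intro J hJ c
  rw [← OmegaOne.mk_eq] at hJ
  obtain ⟨e⟩ : Nonempty (J ↪ OmegaOne) := hJ
  choose d hdc hdisj hsup using fun j => exists_disjointed (c j)
  let D : J → Set B := fun j => {p | p ≠ ⊥ ∧ ∃ o : Option OmegaOne, p = o.elim (⨆ i, c j i)ᶜ (d j)}
  have hD : ∀ j, IsMaximalAntichain (D j) := by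
    intro j
    have hc : ∀ i, (⨆ i, c j i)ᶜ ⊓ d j i = ⊥ := fun i => by
      rw [← le_bot_iff]
      refine (inf_le_inf_left _ (le_iSup (d j) i)).trans ?_
      rw [hsup, compl_inf_self]
    refine ⟨fun p hp => hp.1, ?_, ?_⟩
    · rintro p ⟨-, o, rfl⟩ q ⟨-, o', rfl⟩ hpq
      rcases o with _ | i <;> rcases o' with _ | i'
      · exact (hpq rfl).elim
      · exact hc i'
      · rw [inf_comm]; exact hc i
      · exact hdisj j i i' (by rintro rfl; exact hpq rfl)
    · intro p hp
      by_contra! h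
      have h' : ∀ o : Option OmegaOne, p ⊓ o.elim (⨆ i, c j i)ᶜ (d j) = ⊥ := fun o => by
        by_cases ho : o.elim (⨆ i, c j i)ᶜ (d j) = ⊥
        · rw [ho, inf_bot_eq]
        · exact h _ ⟨ho, o, rfl⟩
      refine hp ?_
      have h1 : p ≤ ⨆ i, c j i := by
        have := h' none
        exact disjoint_compl_right_iff.1 (disjoint_iff.2 this)
      rw [← inf_eq_left.2 h1, ← hsup, inf_iSup_eq]
      simpa using fun i => h' (some i)
  have hDcard : ∀ j, Cardinal.mk (D j) ≤ Cardinal.aleph 1 := by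
    intro j
    have h1 : D j ⊆ range (fun o : Option OmegaOne => o.elim (⨆ i, c j i)ᶜ (d j)) := by
      rintro p ⟨-, o, rfl⟩
      exact ⟨o, rfl⟩
    refine (Cardinal.mk_le_mk_of_subset h1).trans ?_
    have h2 := Cardinal.mk_range_le_lift (f := fun o : Option OmegaOne =>
      o.elim (⨆ i, c j i)ᶜ (d j))
    have h3 : Cardinal.mk (Option OmegaOne) = Cardinal.aleph 1 := by
      rw [Cardinal.mk_option, OmegaOne.mk_eq]
      exact Cardinal.add_one_eq (Cardinal.aleph0_le_aleph 1)
    rw [h3] at h2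
    simpa using h2
  have hone : IsMaximalAntichain ({⊤} : Set B) := by
    have := hB.2.1
    refine ⟨by simp, by simp +contextual, fun p hp => ⟨⊤, rfl, by simpa using hp⟩⟩
  let D' : OmegaOne → Set B := Function.extend e D (fun _ => {⊤})
  have hD' : ∀ i, IsMaximalAntichain (D' i) ∧ Cardinal.mk (D' i) ≤ Cardinal.aleph 1 := by
    intro i
    by_cases h : ∃ j, e j = i
    · obtain ⟨j, rfl⟩ := h
      simp only [D', e.injective.extend_apply]
      exact ⟨hD j, hDcard j⟩
    · simp only [D', Function.extend_apply' _ _ _ h]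
      refine ⟨hone, ?_⟩
      rw [Cardinal.mk_singleton]
      exact (Cardinal.one_lt_aleph0.trans_le (Cardinal.aleph0_le_aleph 1)).le
  obtain ⟨G, hG, hmeet⟩ := hFA X R B hB (fun ξ => D' (Ordinal.ToType.mk ξ)) (fun ξ => hD' _)
  refine ⟨G, hG, fun j => ?_⟩
  obtain ⟨p, hp, hpG⟩ := hmeet (e j).toOrd
  simp only [Ordinal.ToType.toOrd, OrderIso.apply_symm_apply, D', e.injective.extend_apply] at hp
  obtain ⟨-, o, rfl⟩ := hp
  rcases o with _ | i
  · exact Or.inr hpG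
  · exact Or.inl ⟨i, Order.PFilter.mem_of_le (hdc j i) hpG⟩

/-! ### Boolean-valued ranks -/

section Rank

variable {C : Type u} [CompleteBooleanAlgebra C]

/-- The membership relation of `V^C` is well-founded in the Boolean-valued sense, also when it is
restricted to an arbitrary family of names. -/
theorem BName.memVal_induction {ι : Type*} (N : ι → BName C) (f : ι → C)
    (h : ∀ ξ, (⨅ ζ, memVal (N ζ) (N ξ) ⇨ f ζ) ≤ f ξ) (ξ : ι) : f ξ = ⊤ := by
  have key : ∀ x : BName C, ∀ ζ, eqVal x (N ζ) ≤ f ζ := by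
    intro x
    induction x with
    | mk κ xe v ih =>
      intro ζ
      refine le_trans (le_iInf fun ζ' => ?_) (h ζ)
      rw [le_himp_iff]
      have h1 : eqVal (mk κ xe v) (N ζ) ⊓ memVal (N ζ') (N ζ) ≤ memVal (N ζ') (mk κ xe v) := by
        rw [eqVal_symm]
        exact eqVal_inf_memVal_le_right _ _ _
      refine h1.trans (iSup_le fun j => inf_le_right.trans ?_)
      rw [eqVal_symm]
      exact ih j ζ'
  exact top_le_iff.1 ((eqVal_refl (N ξ)).ge.trans (key (N ξ) ξ))

variable {ι : Type*} (E : ι → ι → C)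

/-- The Boolean value of "the rank of `ξ` with respect to `E` is at most `η`". -/
noncomputable def rankLe (η : OmegaOne) (ξ : ι) : C :=
  ⨅ ζ, E ζ ξ ⇨ ⨆ η' : {η' // η' < η}, rankLe η'.1 ζ
termination_by η
decreasing_by exact η'.2

/-- The Boolean value of "the rank of `ξ` with respect to `E` is less than `η`". -/
noncomputable def rankLt (η : OmegaOne) (ξ : ι) : C := ⨆ η' : {η' // η' < η}, rankLe E η'.1 ξ

/-- The Boolean value of "the rank of `ξ` with respect to `E` is `η`". -/
noncomputable def rankEq (η : OmegaOne) (ξ : ι) : C := rankLe E η ξ \ rankLt E η ξ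

theorem rankLe_eq (η : OmegaOne) (ξ : ι) : rankLe E η ξ = ⨅ ζ, E ζ ξ ⇨ rankLt E η ζ := by
  rw [rankLe]; rfl

theorem rankLe_inf_le (η : OmegaOne) (ζ ξ : ι) : rankLe E η ξ ⊓ E ζ ξ ≤ rankLt E η ζ := by
  rw [← le_himp_iff, rankLe_eq]
  exact iInf_le _ ζ

theorem rankLe_le_rankLt {η η' : OmegaOne} (h : η < η') (ξ : ι) :
    rankLe E η ξ ≤ rankLt E η' ξ :=
  le_iSup (fun k : {k // k < η'} => rankLe E k.1 ξ) ⟨η, h⟩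

theorem rankLt_mono {η η' : OmegaOne} (h : η ≤ η') (ξ : ι) : rankLt E η ξ ≤ rankLt E η' ξ :=
  iSup_le fun k => rankLe_le_rankLt E (k.2.trans_le h) ξ

theorem rankEq_inf_rankLt {η η' : OmegaOne} (h : η ≤ η') (ξ : ι) :
    rankEq E η' ξ ⊓ rankLt E η ξ = ⊥ :=
  le_bot_iff.1 ((inf_le_inf_left _ (rankLt_mono E h ξ)).trans (by simp [rankEq]))

theorem rankEq_disjoint {η η' : OmegaOne} (h : η ≠ η') (ξ : ι) :
    rankEq E η ξ ⊓ rankEq E η' ξ = ⊥ := by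
  have key : ∀ {η η' : OmegaOne}, η < η' → rankEq E η ξ ⊓ rankEq E η' ξ = ⊥ := fun {η η'} h => by
    rw [inf_comm, ← le_bot_iff, ← rankEq_inf_rankLt E (le_refl η') ξ]
    exact inf_le_inf_left _ (sdiff_le.trans (rankLe_le_rankLt E h ξ))
  rcases lt_or_gt_of_ne h with h | h
  · exact key h
  · rw [inf_comm]; exact key h

theorem iSup_rankLe_le (ξ : ι) : ⨆ η, rankLe E η ξ ≤ ⨆ η, rankEq E η ξ := by
  refine iSup_le fun η => ?_
  induction η using WellFoundedLT.induction with
  | ind η ih =>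
    refine (le_sdiff_sup (b := rankLe E η ξ) (a := rankLt E η ξ)).trans (sup_le ?_ ?_)
    · exact le_iSup (fun η => rankEq E η ξ) η
    · exact iSup_le fun k => ih k.1 k.2

/-- If `E` is well-founded in the Boolean-valued sense and the rank of some `ξ` is not a countable
ordinal, then every countable ordinal is the rank of some `ζ`. -/
theorem compl_iSup_rankEq_le
    (hE : ∀ f : ι → C, (∀ ξ, (⨅ ζ, E ζ ξ ⇨ f ζ) ≤ f ξ) → ∀ ξ, f ξ = ⊤) (η : OmegaOne) (ξ : ι) :
    (⨆ η, rankEq E η ξ)ᶜ ≤ ⨆ ζ, rankEq E η ζ := by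
  set b := (⨆ ζ, rankEq E η ζ)ᶜ with hb
  -- Below `b` the rank `η` is not attained, so all ranks are less than `η`.
  have h1 : ∀ ζ, b ⊓ rankLe E η ζ ≤ rankLt E η ζ := fun ζ => by
    refine (inf_le_inf_left b (le_sdiff_sup (a := rankLt E η ζ))).trans ?_
    rw [inf_sup_left]
    refine sup_le ((inf_le_inf_left b (le_iSup (fun ζ => rankEq E η ζ) ζ)).trans ?_) inf_le_right
    rw [hb, compl_inf_self]
    exact bot_le
  have h2 := hE (fun ζ => b ⇨ rankLt E η ζ) (fun ζ => by
    rw [le_himp_iff]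
    refine le_trans (le_inf inf_le_right ?_) (h1 ζ)
    rw [rankLe_eq]
    refine le_iInf fun ζ' => ?_
    rw [le_himp_iff]
    calc (⨅ ζ', E ζ' ζ ⇨ b ⇨ rankLt E η ζ') ⊓ b ⊓ E ζ' ζ
        ≤ (E ζ' ζ ⇨ b ⇨ rankLt E η ζ') ⊓ b ⊓ E ζ' ζ :=
          inf_le_inf_right _ (inf_le_inf_right _ (iInf_le _ ζ'))
      _ = ((E ζ' ζ ⇨ b ⇨ rankLt E η ζ') ⊓ E ζ' ζ) ⊓ b := by ac_rfl
      _ ≤ (b ⇨ rankLt E η ζ') ⊓ b := inf_le_inf_right _ himp_inf_le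
      _ ≤ rankLt E η ζ' := himp_inf_le) ξ
  have h3 : b ≤ rankLt E η ξ := himp_eq_top_iff.1 h2
  rw [compl_le_iff_compl_le, ← hb]
  refine h3.trans (le_trans ?_ (iSup_rankLe_le E ξ))
  exact iSup_le fun k => le_iSup (fun η => rankLe E η ξ) k.1

end Rank

/-! ### Filters and well-foundedness -/

section Filter

variable {C : Type u} [CompleteBooleanAlgebra C] {G : Order.PFilter C}

theorem mem_iff_of_cong {a b e : C} (he : e ∈ G) (h : Cong e a b) : a ∈ G ↔ b ∈ G :=
  ⟨fun ha => Order.PFilter.mem_of_le h.le (Order.PFilter.inf_mem he ha),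
    fun hb => Order.PFilter.mem_of_le h.symm.le (Order.PFilter.inf_mem he hb)⟩

theorem inf_ne_bot_of_mem (hG : ⊥ ∉ G) {a b : C} (ha : a ∈ G) (hb : b ∈ G) : a ⊓ b ≠ ⊥ :=
  fun h => hG (h ▸ Order.PFilter.inf_mem ha hb)

theorem compl_mem_iff_of_decides (hG : ⊥ ∉ G) {a : C} (h : a ∈ G ∨ aᶜ ∈ G) : aᶜ ∈ G ↔ a ∉ G :=
  ⟨fun h1 h2 => inf_ne_bot_of_mem hG h2 h1 (inf_compl_self a), fun h1 => h.resolve_left h1⟩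

theorem himp_mem_iff_of_decides {a b : C} (h : a ∈ G ∨ aᶜ ∈ G) :
    a ⇨ b ∈ G ↔ (a ∈ G → b ∈ G) := by
  constructor
  · intro h1 h2
    exact Order.PFilter.mem_of_le himp_inf_le (Order.PFilter.inf_mem h1 h2)
  · intro h1
    rcases h with h | h
    · exact Order.PFilter.mem_of_le le_himp (h1 h)
    · refine Order.PFilter.mem_of_le ?_ h
      rw [le_himp_iff, compl_inf_self]
      exact bot_le

/-- A filter that respects the Boolean-valued ranks of all countable subfamilies turns a family of
names indexed by `ω₁` into a well-founded structure. The point is that it cannot force a rank to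
be uncountable: all countable ordinals would then be ranks of members of a countable family. -/
theorem wellFounded_of_rank (hG : ⊥ ∉ G) (N : OmegaOne → BName C)
    (h₁ : ∀ (δ : OmegaOne) (ξ : Iio δ),
      (∃ η, rankEq (fun ζ ξ : Iio δ => BName.memVal (N ζ) (N ξ)) η ξ ∈ G) ∨
        (⨆ η, rankEq (fun ζ ξ : Iio δ => BName.memVal (N ζ) (N ξ)) η ξ)ᶜ ∈ G)
    (h₂ : ∀ δ η : OmegaOne,
      (∃ ξ, rankEq (fun ζ ξ : Iio δ => BName.memVal (N ζ) (N ξ)) η ξ ∈ G) ∨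
        (⨆ ξ, rankEq (fun ζ ξ : Iio δ => BName.memVal (N ζ) (N ξ)) η ξ)ᶜ ∈ G) :
    WellFounded fun m n => BName.memVal (N m) (N n) ∈ G := by
  rw [wellFounded_iff_isEmpty_descending_chain]
  refine ⟨fun ⟨f, hf⟩ => ?_⟩
  obtain ⟨δ, hδ⟩ := OmegaOne.exists_gt_of_countable (countable_range f)
  set E := fun ζ ξ : Iio δ => BName.memVal (N ζ) (N ξ)
  let g : ℕ → Iio δ := fun k => ⟨f k, hδ _ (mem_range_self k)⟩
  have hrank : ∀ ξ : Iio δ, ∃ η, rankEq E η ξ ∈ G := by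
    intro ξ
    refine (h₁ δ ξ).resolve_right fun hξ => ?_
    have h3 : ∀ η, ∃ ζ, rankEq E η ζ ∈ G := fun η => (h₂ δ η).resolve_right fun h4 => by
      have h5 := Order.PFilter.mem_of_le (compl_iSup_rankEq_le E
        (fun f hf => BName.memVal_induction (fun ζ : Iio δ => N ζ) f hf) η ξ) hξ
      exact inf_ne_bot_of_mem hG h5 h4 (inf_compl_self _)
    choose z hz using h3
    have hinj : Function.Injective z := fun η η' h => by
      by_contra hne
      exact inf_ne_bot_of_mem hG (hz η) (h ▸ hz η') (rankEq_disjoint E hne _)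
    have := (OmegaOne.countable_Iio δ).to_subtype
    exact not_countable (α := OmegaOne) hinj.countable
  choose r hr using fun k => hrank (g k)
  have hdec : ∀ k, r (k + 1) < r k := by
    intro k
    by_contra! hle
    have h3 : rankLt E (r k) (g (k + 1)) ∈ G :=
      Order.PFilter.mem_of_le (rankLe_inf_le E (r k) (g (k + 1)) (g k))
        (Order.PFilter.inf_mem (Order.PFilter.mem_of_le sdiff_le (hr k)) (hf k))
    exact inf_ne_bot_of_mem hG (hr (k + 1)) h3 (rankEq_inf_rankLt E hle _)
  exact (RelEmbedding.natGT r hdec).not_wellFounded wellFounded_lt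

end Filter

/-! ### Sets of names closed under witnesses -/

section Witness

open Cardinal

theorem mk_sigma_boundedFormula_le :
    #(Σ n, setLanguage.BoundedFormula (Fin 1) n) ≤ ℵ₀ := by
  have hc : setLanguage.card ≤ ℵ₀ := by
    have h1 : Countable (Σ l, setLanguage.Functions l) := ⟨fun p => p.2.elim, fun p => p.2.elim⟩
    have h2 : Countable (Σ l, setLanguage.Relations l) := by
      refine ⟨fun p => p.1, ?_⟩
      rintro ⟨n, r⟩ ⟨m, s⟩ h
      cases r
      cases s
      rfl
    have h3 : Countable setLanguage.Symbols := instCountableSum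
    exact mk_le_aleph0
  refine BoundedFormula.card_le.trans (max_le le_rfl ?_)
  refine add_le_aleph0.2 ⟨?_, ?_⟩
  · exact lift_le_aleph0.2 mk_le_aleph0
  · exact lift_le_aleph0.2 hc

/-- The language with one function symbol for each formula. -/
def witnessLanguage : FirstOrder.Language :=
  ⟨fun n => setLanguage.BoundedFormula (Fin 1) (n + 1), fun _ => Empty⟩

variable {C : Type u} [CompleteBooleanAlgebra C]

theorem BName.exists_witness {α : Type} {n : ℕ} (χ : setLanguage.BoundedFormula α (n + 1))
    (v : α → BName C) (xs : Fin n → BName C) :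
    ∃ w, ⨆ x, truth χ v (Fin.snoc xs x) ≤ truth χ v (Fin.snoc xs w) :=
  exists_iSup_le _ fun x y => (truth_cong χ (fun i => le_eqVal_refl _ _) fun i => by
    refine Fin.lastCases ?_ (fun i => ?_) i
    · simp
    · simp [le_eqVal_refl]).le

/-- A downward Löwenheim–Skolem argument in `V^C`: every family of `ℵ₁` many names is contained in
one that is closed under witnesses given by the maximum principle. -/
theorem BName.exists_closed_family (v : Fin 1 → BName C) (s : OmegaOne → BName C) :
    ∃ N : OmegaOne → BName C, (∀ i, ∃ k, N k = s i) ∧ (∃ k, N k = v 0) ∧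
      ∀ (n : ℕ) (χ : setLanguage.BoundedFormula (Fin 1) (n + 1)) (xs : Fin n → OmegaOne),
        ∃ w, ⨆ x, truth χ v (Fin.snoc (N ∘ xs) x) ≤ truth χ v (Fin.snoc (N ∘ xs) (N w)) := by
  let _ : witnessLanguage.Structure (BName C) :=
    { funMap := fun {n} χ xs => (exists_witness (n := n) χ v xs).choose
      RelMap := fun r => r.elim }
  let S : Set (BName C) := insert (v 0) (range s)
  let M := Substructure.closure witnessLanguage S
  have hS : S ⊆ M := Substructure.subset_closure
  have hS1 : lift.{0} #S ≤ aleph 1 := by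
    rw [lift_uzero]
    refine (mk_insert_le).trans ?_
    have h1 := mk_range_le_lift (f := s)
    rw [OmegaOne.mk_eq] at h1
    have h2 : #(range s) ≤ aleph 1 := by simpa using h1
    refine (add_le_add_left h2 1).trans ?_
    exact (add_one_eq (aleph0_le_aleph 1)).le
  have hfun : #(Σ n, witnessLanguage.Functions n) ≤ ℵ₀ := by
    refine le_trans ?_ mk_sigma_boundedFormula_le
    refine mk_le_of_injective
      (f := fun p : Σ n, witnessLanguage.Functions n => (⟨p.1 + 1, p.2⟩ :
        Σ n, setLanguage.BoundedFormula (Fin 1) n)) ?_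
    rintro ⟨n, χ⟩ ⟨m, χ'⟩ h
    obtain ⟨h1, h2⟩ := Sigma.mk.inj_iff.1 h
    obtain rfl : n = m := Nat.add_right_cancel h1
    exact congrArg (Sigma.mk n) (eq_of_heq h2)
  have hM : lift.{0} #M ≤ lift.{u + 1} #OmegaOne := by
    refine (Substructure.lift_card_closure_le (L := witnessLanguage) (s := S)).trans ?_
    rw [OmegaOne.mk_eq, lift_aleph, Ordinal.lift_one]
    refine max_le (aleph0_le_aleph 1) ?_
    refine (add_le_add hS1 (lift_le_aleph0.2 hfun |>.trans (aleph0_le_aleph 1))).trans ?_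
    exact (add_eq_self (aleph0_le_aleph 1)).le
  obtain ⟨e⟩ := lift_mk_le'.1 hM
  have : Nonempty M := ⟨⟨v 0, hS (mem_insert _ _)⟩⟩
  let N : OmegaOne → BName C := fun k => (Function.invFun e k : M)
  have hN : ∀ x ∈ M, ∃ k, N k = x := fun x hx =>
    ⟨e ⟨x, hx⟩, by simp only [N, Function.leftInverse_invFun e.injective ⟨x, hx⟩]⟩
  refine ⟨N, fun i => hN _ (hS (mem_insert_of_mem _ (mem_range_self i))),
    hN _ (hS (mem_insert _ _)), fun n χ xs => ?_⟩
  have h1 : Structure.funMap (L := witnessLanguage) (n := n) χ (N ∘ xs) ∈ M :=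
    M.fun_mem _ _ fun i => (Function.invFun e (xs i)).2
  obtain ⟨w, hw⟩ := hN _ h1
  refine ⟨w, ?_⟩
  rw [hw]
  exact (exists_witness (n := n) χ v (N ∘ xs)).choose_spec

theorem mk_prod_le_aleph_one {α β : Type} (hα : #α ≤ aleph 1) (hβ : #β ≤ aleph 1) :
    #(α × β) ≤ aleph 1 := by
  rw [mk_prod, lift_id, lift_id]
  exact (mul_le_mul' hα hβ).trans (mul_eq_self (aleph0_le_aleph 1)).le

theorem mk_sum_le_aleph_one {α β : Type} (hα : #α ≤ aleph 1) (hβ : #β ≤ aleph 1) :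
    #(α ⊕ β) ≤ aleph 1 := by
  rw [mk_sum, lift_id, lift_id]
  exact (add_le_add hα hβ).trans (add_eq_self (aleph0_le_aleph 1)).le

theorem mk_formula_prod_assignment_le :
    #(Σ n, setLanguage.BoundedFormula (Fin 1) n × (Fin n → OmegaOne)) ≤ aleph 1 := by
  have h1 : #((Σ n, setLanguage.BoundedFormula (Fin 1) n) × List OmegaOne) ≤ aleph 1 := by
    refine mk_prod_le_aleph_one (mk_sigma_boundedFormula_le.trans (aleph0_le_aleph 1)) ?_
    rw [mk_list_eq_mk, OmegaOne.mk_eq]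
  refine le_trans (mk_le_of_injective (f := fun p => (⟨p.1, p.2.1⟩, List.ofFn p.2.2)) ?_) h1
  rintro ⟨n, χ, xs⟩ ⟨m, χ', xs'⟩ h
  obtain ⟨h2, h3⟩ := Prod.mk.inj h
  obtain ⟨h4, h5⟩ := Sigma.mk.inj_iff.1 h2
  obtain rfl : n = m := h4
  obtain rfl : χ = χ' := eq_of_heq h5
  obtain rfl : xs = xs' := List.ofFn_injective h3
  rfl

end Witness

/-! ### The collapse of a small set of names -/

section Collapse

variable {C : Type u} [CompleteBooleanAlgebra C]

theorem BName.subsetVal_inf_subsetVal_le (x y : BName C) :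
    subsetVal x y ⊓ subsetVal y x ≤ eqVal x y := by
  rw [eqVal_def]
  refine le_inf (le_iInf fun i => ?_) (le_iInf fun j => ?_)
  · refine inf_le_left.trans ((iInf_le _ (x.elt i)).trans ?_)
    exact himp_le_himp_right (val_le_memVal x i)
  · refine inf_le_right.trans ((iInf_le _ (y.elt j)).trans ?_)
    refine himp_le_himp (val_le_memVal y j) (iSup_mono fun i => ?_)
    rw [eqVal_symm]

theorem sum_elim_snoc_castSucc {M : Type*} {α : Type} {n : ℕ} (v : α → M) (xs : Fin n → M) (x : M)
    (t : α ⊕ Fin n) :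
    Sum.elim v (Fin.snoc xs x : Fin (n + 1) → M) (Sum.map id Fin.castSucc t) = Sum.elim v xs t := by
  cases t <;> simp

theorem realize_memFormula {α : Type} {n : ℕ} (v : α → ZFSet.{u}) (xs : Fin n → ZFSet.{u})
    (s t : α ⊕ Fin n) :
    (memFormula s t).Realize v xs ↔ Sum.elim v xs s ∈ Sum.elim v xs t := Iff.rfl

theorem realize_memFormula_last {α : Type} {n : ℕ} (v : α → ZFSet.{u}) (xs : Fin n → ZFSet.{u})
    (x : ZFSet.{u}) (t : α ⊕ Fin n) :
    (memFormula (Sum.inr (Fin.last n)) (Sum.map id Fin.castSucc t)).Realize v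
      (Fin.snoc xs x : Fin (n + 1) → ZFSet.{u}) ↔ x ∈ Sum.elim v xs t := by
  rw [realize_memFormula, sum_elim_snoc_castSucc, Sum.elim_inr, Fin.snoc_last]

namespace BName

variable {α : Type} {n : ℕ} (v : α → BName C) (xs : Fin n → BName C)

theorem truth_memFormula (s t : α ⊕ Fin n) :
    truth (memFormula s t) v xs = memVal (Sum.elim v xs s) (Sum.elim v xs t) := rfl

theorem truth_not (χ : setLanguage.BoundedFormula α n) :
    truth χ.not v xs = (truth χ v xs)ᶜ := himp_bot _

theorem truth_inf (χ ψ : setLanguage.BoundedFormula α n) :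
    truth (χ ⊓ ψ) v xs = truth χ v xs ⊓ truth ψ v xs := by
  change truth (χ.imp ψ.not).not v xs = _
  rw [truth_not, truth, truth_not, himp_eq, compl_sup, compl_compl, compl_compl, inf_comm]

theorem truth_ex (χ : setLanguage.BoundedFormula α (n + 1)) :
    truth χ.ex v xs = ⨆ x, truth χ v (Fin.snoc xs x) := by
  change truth χ.not.all.not v xs = _
  rw [truth_not, truth, compl_iInf]
  exact iSup_congr fun x => by rw [truth_not, compl_compl]

end BName

open BName in
/-- **Generic absoluteness.** A `Σ₁` statement about a subset of `ω₁` that has Boolean value `1` in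
`V^C` is true, provided that `C` has filters respecting `ℵ₁` many suprema of size `ℵ₁`. -/
theorem realize_of_truth_eq_top (hC : HasGenericFilters C) {φ : setLanguage.Formula (Fin 1)}
    (hφ : IsSigma1 φ) {A : ZFSet.{u}} (hA : A ⊆ (Ordinal.omega.{u} 1).toZFSet)
    (h : truth φ ![check C A] ![] = ⊤) : φ.Realize ![A] := by
  classical
  obtain ⟨N, hNs, ⟨iA, hNA⟩, hNw⟩ :=
    exists_closed_family ![check C A] fun i => check C (OmegaOne.toZFSet i)
  choose s hs using hNs
  let v : Fin 1 → BName C := ![check C A]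
  let X : Option OmegaOne → ZFSet.{u} := fun o => o.elim A OmegaOne.toZFSet
  have hX : ∀ o, X o ⊆ (Ordinal.omega.{u} 1).toZFSet := by
    rintro (_ | i)
    · exact hA
    · intro x hx
      obtain ⟨k, -, rfl⟩ := OmegaOne.mem_toZFSet.1 hx
      exact OmegaOne.mem_toZFSet_omega.2 ⟨k, rfl⟩
  let E : ∀ δ : OmegaOne, Iio δ → Iio δ → C := fun δ ζ ξ => memVal (N ζ) (N ξ)
  -- The suprema that the filter has to respect.
  let J : Type := ((Σ n, setLanguage.BoundedFormula (Fin 1) n × (Fin n → OmegaOne)) ⊕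
    (OmegaOne × Option OmegaOne)) ⊕ ((Σ δ : OmegaOne, Iio δ) ⊕ (OmegaOne × OmegaOne))
  let c : J → OmegaOne → C := fun j => match j with
    | .inl (.inl ⟨_, χ, xs⟩) => fun _ => truth χ v (N ∘ xs)
    | .inl (.inr (n, o)) => fun k =>
        if OmegaOne.toZFSet k ∈ X o then eqVal (N n) (check C (OmegaOne.toZFSet k)) else ⊥
    | .inr (.inl ⟨δ, ξ⟩) => fun η => rankEq (E δ) η ξ
    | .inr (.inr (δ, η)) => fun ξ => if h : ξ < δ then rankEq (E δ) η ⟨ξ, h⟩ else ⊥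
  have hJ : Cardinal.mk J ≤ Cardinal.aleph 1 := by
    have h1 : Cardinal.mk OmegaOne ≤ Cardinal.aleph 1 := OmegaOne.mk_eq.le
    have h2 : Cardinal.mk (Option OmegaOne) ≤ Cardinal.aleph 1 := by
      rw [Cardinal.mk_option, OmegaOne.mk_eq]
      exact (Cardinal.add_one_eq (Cardinal.aleph0_le_aleph 1)).le
    have h3 : Cardinal.mk (Σ δ : OmegaOne, Iio δ) ≤ Cardinal.aleph 1 := by
      refine le_trans (Cardinal.mk_le_of_injective (f := fun p => (p.1, (p.2 : OmegaOne))) ?_)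
        (mk_prod_le_aleph_one h1 h1)
      rintro ⟨δ, ξ, hξ⟩ ⟨δ', ξ', hξ'⟩ h
      obtain ⟨rfl, rfl⟩ := Prod.mk.inj h
      rfl
    exact mk_sum_le_aleph_one (mk_sum_le_aleph_one mk_formula_prod_assignment_le
      (mk_prod_le_aleph_one h1 h2)) (mk_sum_le_aleph_one h3 (mk_prod_le_aleph_one h1 h1))
  obtain ⟨G, hG, hGc⟩ := hC hJ c
  have hdec : ∀ {n : ℕ} (χ : setLanguage.BoundedFormula (Fin 1) n) (xs : Fin n → OmegaOne),
      truth χ v (N ∘ xs) ∈ G ∨ (truth χ v (N ∘ xs))ᶜ ∈ G := fun {n} χ xs => by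
    have h1 := hGc (.inl (.inl ⟨n, χ, xs⟩))
    simpa [c] using h1
  have hcheck : ∀ n o, memVal (N n) (check C (X o)) ∈ G ↔
      ∃ k, OmegaOne.toZFSet k ∈ X o ∧ eqVal (N n) (check C (OmegaOne.toZFSet k)) ∈ G := by
    intro n o
    have h1 : memVal (N n) (check C (X o)) = ⨆ k, c (.inl (.inr (n, o))) k := by
      rw [memVal_check]
      refine le_antisymm (iSup_le fun y => ?_) (iSup_le fun k => ?_)
      · obtain ⟨y, hy⟩ := y
        obtain ⟨k, rfl⟩ := OmegaOne.mem_toZFSet_omega.1 (hX o hy)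
        refine le_iSup_of_le k ?_
        simp only [c, if_pos hy, le_refl]
      · by_cases hk : OmegaOne.toZFSet k ∈ X o
        · simp only [c, if_pos hk]
          exact le_iSup (fun y : {y // y ∈ X o} => eqVal (N n) (check C y)) ⟨_, hk⟩
        · simp only [c, if_neg hk, bot_le]
    constructor
    · intro h2
      rcases hGc (.inl (.inr (n, o))) with ⟨k, hk⟩ | h3
      · by_cases hkX : OmegaOne.toZFSet k ∈ X o
        · simp only [c, if_pos hkX] at hk
          exact ⟨k, hkX, hk⟩
        · simp only [c, if_neg hkX] at hk
          exact (hG hk).elim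
      · rw [h1] at h2
        exact (inf_ne_bot_of_mem hG h2 h3 (inf_compl_self _)).elim
    · rintro ⟨k, hk, h2⟩
      refine Order.PFilter.mem_of_le ?_ h2
      rw [memVal_check]
      exact le_iSup (fun y : {y // y ∈ X o} => eqVal (N n) (check C y)) ⟨_, hk⟩
  have hwf : WellFounded fun m n => memVal (N m) (N n) ∈ G := by
    refine wellFounded_of_rank hG N (fun δ ξ => hGc (.inr (.inl ⟨δ, ξ⟩))) fun δ η => ?_
    have h1 : ⨆ ξ, c (.inr (.inr (δ, η))) ξ = ⨆ ξ, rankEq (E δ) η ξ := by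
      refine le_antisymm (iSup_le fun ξ => ?_) (iSup_le fun ξ => ?_)
      · by_cases hξ : ξ < δ
        · simp only [c, dif_pos hξ]
          exact le_iSup (fun ξ => rankEq (E δ) η ξ) ⟨ξ, hξ⟩
        · simp only [c, dif_neg hξ, bot_le]
      · refine le_iSup_of_le ξ.1 ?_
        have hξ : ξ.1 < δ := ξ.2
        simp only [c, dif_pos hξ, le_refl]
    rcases hGc (.inr (.inr (δ, η))) with ⟨ξ, hξ⟩ | h2
    · left
      by_cases hlt : ξ < δ
      · simp only [c, dif_pos hlt] at hξ
        exact ⟨_, hξ⟩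
      · simp only [c, dif_neg hlt] at hξ
        exact (hG hξ).elim
    · right
      rwa [h1] at h2
  -- Quantifiers over `V^C` are witnessed in the family `N`.
  have hall : ∀ {n : ℕ} (χ : setLanguage.BoundedFormula (Fin 1) (n + 1)) (xs : Fin n → OmegaOne),
      truth χ.all v (N ∘ xs) ∈ G ↔ ∀ w, truth χ v (N ∘ Fin.snoc xs w) ∈ G := by
    intro n χ xs
    have hsnoc : ∀ w, Fin.snoc (N ∘ xs) (N w) = N ∘ (Fin.snoc xs w : Fin (n + 1) → OmegaOne) :=
      fun w => (Fin.comp_snoc _ _ _).symm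
    constructor
    · intro h1 w
      rw [← hsnoc]
      exact Order.PFilter.mem_of_le (iInf_le _ (N w)) h1
    · intro h1
      obtain ⟨w, hw⟩ := hNw n χ.not xs
      have h2 : ∀ xs' : Fin (n + 1) → BName C,
          truth χ.not ![check C A] xs' = (truth χ v xs')ᶜ := fun xs' => himp_bot _
      simp only [h2] at hw
      rw [← compl_iInf, compl_le_compl_iff_le, hsnoc] at hw
      exact Order.PFilter.mem_of_le hw (h1 w)
  have hex : ∀ {n : ℕ} (χ : setLanguage.BoundedFormula (Fin 1) (n + 1)) (xs : Fin n → OmegaOne),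
      truth χ.ex v (N ∘ xs) ∈ G ↔ ∃ w, truth χ v (N ∘ Fin.snoc xs w) ∈ G := by
    intro n χ xs
    change truth χ.not.all.not v (N ∘ xs) ∈ G ↔ _
    rw [truth_not, compl_mem_iff_of_decides hG (hdec _ _), hall, not_forall]
    refine exists_congr fun w => ?_
    rw [truth_not, compl_mem_iff_of_decides hG (hdec _ _), not_not]
  -- The Mostowski collapse.
  obtain ⟨π, hπ⟩ : ∃ π : OmegaOne → ZFSet.{u},
      ∀ n z, z ∈ π n ↔ ∃ m, memVal (N m) (N n) ∈ G ∧ π m = z := by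
    refine ⟨hwf.fix fun n ih => ZFSet.range fun m : {m // memVal (N m) (N n) ∈ G} => ih m.1 m.2,
      fun n z => ?_⟩
    rw [hwf.fix_eq]
    simp
  have hsub : ∀ m n, subsetVal (N m) (N n) ∈ G ↔
      ∀ k, memVal (N k) (N m) ∈ G → memVal (N k) (N n) ∈ G := by
    intro m n
    let χ : setLanguage.BoundedFormula (Fin 1) 3 :=
      (memFormula (Sum.inr 2) (Sum.inr 0)).imp (memFormula (Sum.inr 2) (Sum.inr 1))
    refine (hall χ ![m, n]).trans (forall_congr' fun k => ?_)
    have h1 := hdec (memFormula (Sum.inr 2) (Sum.inr 0)) (Fin.snoc ![m, n] k)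
    exact himp_mem_iff_of_decides h1
  have hπ_eq : ∀ m n, π m = π n ↔ eqVal (N m) (N n) ∈ G := by
    intro m
    induction m using hwf.induction with
    | _ m ih =>
      intro n
      constructor
      · intro h1
        refine Order.PFilter.mem_of_le (subsetVal_inf_subsetVal_le _ _)
          (Order.PFilter.inf_mem ((hsub m n).2 fun k hk => ?_) ((hsub n m).2 fun k hk => ?_))
        · have h2 : π k ∈ π n := h1 ▸ (hπ m _).2 ⟨k, hk, rfl⟩
          obtain ⟨k', hk', h3⟩ := (hπ n _).1 h2
          have h4 := (ih k hk k').1 h3.symm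
          exact (mem_iff_of_cong h4 (memVal_cong le_rfl (le_eqVal_refl _ _))).2 hk'
        · have h2 : π k ∈ π m := h1 ▸ (hπ n _).2 ⟨k, hk, rfl⟩
          obtain ⟨k', hk', h3⟩ := (hπ m _).1 h2
          have h4 := (ih k' hk' k).1 h3
          exact (mem_iff_of_cong h4 (memVal_cong le_rfl (le_eqVal_refl _ _))).1 hk'
      · intro h1
        ext z
        rw [hπ, hπ]
        exact exists_congr fun k => and_congr_left fun _ =>
          mem_iff_of_cong h1 (memVal_cong (le_eqVal_refl _ _) le_rfl)
  have hπ_mem : ∀ m n, π m ∈ π n ↔ memVal (N m) (N n) ∈ G := by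
    intro m n
    rw [hπ]
    constructor
    · rintro ⟨k, hk, h1⟩
      exact (mem_iff_of_cong ((hπ_eq k m).1 h1)
        (memVal_cong le_rfl (le_eqVal_refl _ _))).1 hk
    · exact fun h1 => ⟨m, h1, rfl⟩
  have hπ_check : ∀ o n, N n = check C (X o) →
      (∀ k, OmegaOne.toZFSet k ∈ X o → π (s k) = OmegaOne.toZFSet k) → π n = X o := by
    intro o n hn h1
    ext z
    rw [hπ]
    constructor
    · rintro ⟨m, hm, rfl⟩
      rw [hn, hcheck] at hm
      obtain ⟨k, hk, h2⟩ := hm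
      rw [← hs, ← hπ_eq] at h2
      rwa [h2, h1 k hk]
    · intro hz
      obtain ⟨k, rfl⟩ := OmegaOne.mem_toZFSet_omega.1 (hX o hz)
      refine ⟨s k, ?_, h1 k hz⟩
      rw [hn, hcheck]
      exact ⟨k, hz, by rw [hs, eqVal_refl]; exact Order.PFilter.top_mem⟩
  have hπ_s : ∀ k, π (s k) = OmegaOne.toZFSet k := by
    intro k
    induction k using WellFoundedLT.induction with
    | ind k ih =>
      exact hπ_check (some k) _ (hs k) fun i hi => ih i (OmegaOne.toZFSet_mem_toZFSet.1 hi)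
  have hπ_A : π iA = A := hπ_check none iA hNA fun k _ => hπ_s k
  -- Łoś's theorem and the absoluteness of `Δ₀` formulas, in one step.
  have hvar : ∀ {n : ℕ} (xs : Fin n → OmegaOne) (t : Fin 1 ⊕ Fin n), ∃ k,
      Sum.elim v (N ∘ xs) t = N k ∧ Sum.elim ![A] (π ∘ xs) t = π k := by
    rintro n xs (t | t)
    · rw [Subsingleton.elim t 0]
      exact ⟨iA, hNA.symm, hπ_A.symm⟩
    · exact ⟨xs t, rfl, rfl⟩
  have hrange : ∀ {n : ℕ} (xs : Fin n → OmegaOne) (t : Fin 1 ⊕ Fin n),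
      ∀ z ∈ Sum.elim ![A] (π ∘ xs) t, ∃ w, π w = z := by
    intro n xs t z hz
    obtain ⟨k, -, hk⟩ := hvar xs t
    rw [hk] at hz
    obtain ⟨w, -, hw⟩ := (hπ k z).1 hz
    exact ⟨w, hw⟩
  have hmem : ∀ {n : ℕ} (xs : Fin n → OmegaOne) (s t : Fin 1 ⊕ Fin n),
      truth (memFormula s t) v (N ∘ xs) ∈ G ↔ (memFormula s t).Realize ![A] (π ∘ xs) := by
    intro n xs s t
    obtain ⟨i, hi, hi'⟩ := hvar xs s
    obtain ⟨j, hj, hj'⟩ := hvar xs t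
    change memVal (Sum.elim v (N ∘ xs) s) (Sum.elim v (N ∘ xs) t) ∈ G ↔
      Sum.elim ![A] (π ∘ xs) s ∈ Sum.elim ![A] (π ∘ xs) t
    rw [hi, hi', hj, hj', hπ_mem]
  have hlos : ∀ {n : ℕ} {χ : setLanguage.BoundedFormula (Fin 1) n}, IsDelta0 χ →
      ∀ xs : Fin n → OmegaOne, truth χ v (N ∘ xs) ∈ G ↔ χ.Realize ![A] (π ∘ xs) := by
    intro n χ hχ
    induction hχ with
    | falsum => exact fun xs => iff_of_false hG id
    | equal s t =>
      intro xs
      obtain ⟨s, rfl⟩ := setLanguage_term_eq_var s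
      obtain ⟨t, rfl⟩ := setLanguage_term_eq_var t
      obtain ⟨i, hi, hi'⟩ := hvar xs s
      obtain ⟨j, hj, hj'⟩ := hvar xs t
      change eqVal (Sum.elim v (N ∘ xs) s) (Sum.elim v (N ∘ xs) t) ∈ G ↔
        Sum.elim ![A] (π ∘ xs) s = Sum.elim ![A] (π ∘ xs) t
      rw [hi, hi', hj, hj', hπ_eq]
    | rel r ts =>
      intro xs
      cases r with
      | mem =>
        obtain ⟨s, hs'⟩ := setLanguage_term_eq_var (ts 0)
        obtain ⟨t, ht'⟩ := setLanguage_term_eq_var (ts 1)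
        have h1 : ts = ![Term.var s, Term.var t] := by
          ext i
          fin_cases i
          exacts [hs', ht']
        subst h1
        exact hmem xs s t
    | @imp n χ ψ _ _ ih₁ ih₂ =>
      intro xs
      rw [BoundedFormula.realize_imp, ← ih₁, ← ih₂]
      exact himp_mem_iff_of_decides (hdec χ xs)
    | @ball n t χ _ ih =>
      intro xs
      rw [hall, BoundedFormula.realize_all]
      have h1 : ∀ w, truth ((memFormula (Sum.inr (Fin.last n)) (Sum.map id Fin.castSucc t)).imp χ)
          v (N ∘ Fin.snoc xs w) ∈ G ↔ (π w ∈ Sum.elim ![A] (π ∘ xs) t →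
            χ.Realize ![A] (Fin.snoc (π ∘ xs) (π w))) := fun w => by
        refine (himp_mem_iff_of_decides (hdec _ _)).trans ?_
        rw [hmem, ih, Fin.comp_snoc, realize_memFormula_last]
      simp only [h1, BoundedFormula.realize_imp, realize_memFormula_last]
      constructor
      · intro h2 z hz
        obtain ⟨w, rfl⟩ := hrange xs t z hz
        exact h2 w hz
      · exact fun h2 w => h2 (π w)
    | @bex n t χ _ ih =>
      intro xs
      rw [hex, BoundedFormula.realize_ex]
      have h1 : ∀ w, truth ((memFormula (Sum.inr (Fin.last n)) (Sum.map id Fin.castSucc t)) ⊓ χ)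
          v (N ∘ Fin.snoc xs w) ∈ G ↔ (π w ∈ Sum.elim ![A] (π ∘ xs) t ∧
            χ.Realize ![A] (Fin.snoc (π ∘ xs) (π w))) := fun w => by
        rw [BName.truth_inf, Order.PFilter.inf_mem_iff, hmem, ih, Fin.comp_snoc,
          realize_memFormula_last]
      simp only [h1, BoundedFormula.realize_inf, realize_memFormula_last]
      constructor
      · rintro ⟨w, h2⟩
        exact ⟨π w, h2⟩
      · rintro ⟨z, hz, h2⟩
        obtain ⟨w, rfl⟩ := hrange xs t z hz
        exact ⟨w, hz, h2⟩
  have hsigma : ∀ {n : ℕ} {χ : setLanguage.BoundedFormula (Fin 1) n}, IsSigma1 χ →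
      ∀ xs : Fin n → OmegaOne, truth χ v (N ∘ xs) ∈ G → χ.Realize ![A] (π ∘ xs) := by
    intro n χ hχ
    induction hχ with
    | delta0 hχ => exact fun xs => (hlos hχ xs).1
    | @ex n χ _ ih =>
      intro xs h1
      rw [hex] at h1
      obtain ⟨w, hw⟩ := h1
      have h2 := ih _ hw
      rw [Fin.comp_snoc] at h2
      exact BoundedFormula.realize_ex.2 ⟨π w, h2⟩
  have h1 := hsigma hφ ![] (by
    rw [Subsingleton.elim (N ∘ ![]) ![], h]
    exact Order.PFilter.top_mem)
  unfold Formula.Realize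
  convert h1

end Collapse

/-! ### Regular open sets -/

namespace RegularOpen

variable {P : Type u} [Preorder P]

/-- The lower set underlying a regular open set. -/
def toLowerSet (U : RegularOpen P) : LowerSet P := Heyting.Regular.val U

/-- The regularization of a lower set. -/
def ofLowerSet (L : LowerSet P) : RegularOpen P := Heyting.Regular.toRegular L

theorem _root_.LowerSet.mem_compl_heyting {L : LowerSet P} {p : P} :
    p ∈ Lᶜ ↔ ∀ q ≤ p, q ∉ L := by
  rw [← LowerSet.Iic_le, le_compl_iff_disjoint_right, disjoint_iff_inf_le]
  constructor
  · intro h q hq hL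
    exact h (show q ∈ LowerSet.Iic p ⊓ L from ⟨hq, hL⟩)
  · rintro h q ⟨hq, hL⟩
    exact (h q hq hL).elim

theorem mem_ofLowerSet {L : LowerSet P} {p : P} :
    p ∈ (ofLowerSet L).toLowerSet ↔ ∀ q ≤ p, ∃ r ≤ q, r ∈ L := by
  change p ∈ Lᶜᶜ ↔ _
  simp only [LowerSet.mem_compl_heyting, not_forall, not_not, exists_prop]

theorem le_iff {U V : RegularOpen P} : U ≤ V ↔ ∀ p ∈ U.toLowerSet, p ∈ V.toLowerSet := Iff.rfl

/-- A regular open set contains every condition below which it is dense. -/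
theorem mem_of_dense {U : RegularOpen P} {p : P} (h : ∀ q ≤ p, ∃ r ≤ q, r ∈ U.toLowerSet) :
    p ∈ U.toLowerSet := by
  have h1 : (U.toLowerSet)ᶜᶜ = U.toLowerSet := Heyting.Regular.prop U
  rw [← h1]
  simpa only [LowerSet.mem_compl_heyting, not_forall, not_not, exists_prop] using h

theorem ext_toLowerSet {U V : RegularOpen P} (h : ∀ p, p ∈ U.toLowerSet ↔ p ∈ V.toLowerSet) :
    U = V :=
  le_antisymm (le_iff.2 fun p => (h p).1) (le_iff.2 fun p => (h p).2)

theorem mem_inf {U V : RegularOpen P} {p : P} :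
    p ∈ (U ⊓ V).toLowerSet ↔ p ∈ U.toLowerSet ∧ p ∈ V.toLowerSet := Iff.rfl

end RegularOpen

/-! ### The first step of a two-step iteration -/

namespace Iteration

variable {B : Type u} [CompleteBooleanAlgebra B] {X R : BName B} {b : B}
  [hb : Fact (b ≤ BName.isCompleteBooleanAlgebraVal X R)]

/-- Strengthening the first coordinate of a condition. -/
def restrict (c : Iteration X R b) (p : B) (hp : c.fst ⊓ p ≠ ⊥) : Iteration X R b where
  fst := c.fst ⊓ p
  snd := c.snd
  fst_ne_bot := hp
  fst_le := inf_le_left.trans c.fst_le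
  forces_mem := inf_le_left.trans c.forces_mem
  forces_ne_zero := inf_le_left.trans c.forces_ne_zero

theorem restrict_le (c : Iteration X R b) (p : B) (hp : c.fst ⊓ p ≠ ⊥) : c.restrict p hp ≤ c :=
  ⟨inf_le_left, inf_le_left.trans (le_refl c).2⟩

/-- The canonical embedding of `B` into the completion of the iteration. -/
def embed (p : B) : RegularOpen (Iteration X R b) :=
  RegularOpen.ofLowerSet ⟨{c | c.fst ≤ p}, fun _ _ h hc => h.1.trans hc⟩

theorem mem_embed {p : B} {c : Iteration X R b} : c ∈ (embed p).toLowerSet ↔ c.fst ≤ p := by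
  refine RegularOpen.mem_ofLowerSet.trans ⟨fun h => ?_, fun h q hq => ⟨q, le_rfl, hq.1.trans h⟩⟩
  by_contra hne
  obtain ⟨r, hr, hrp⟩ := h (c.restrict pᶜ fun h => hne (disjoint_compl_right_iff.1
    (disjoint_iff.2 h))) (restrict_le _ _ _)
  have h1 : r.fst ≤ c.fst ⊓ pᶜ := hr.1
  have h2 : r.fst ≤ p := hrp
  exact r.fst_ne_bot (le_bot_iff.1 ((le_inf h2 (h1.trans inf_le_right)).trans
    (inf_compl_self p).le))

theorem embed_inf_embed_eq_bot {p q : B} (h : p ⊓ q = ⊥) :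
    (embed p ⊓ embed q : RegularOpen (Iteration X R b)) = ⊥ := by
  refine le_bot_iff.1 (RegularOpen.le_iff.2 fun c hc => ?_)
  obtain ⟨h1, h2⟩ := RegularOpen.mem_inf.1 hc
  rw [mem_embed] at h1 h2
  exact (c.fst_ne_bot (le_bot_iff.1 ((le_inf h1 h2).trans h.le))).elim

theorem iSup_embed_eq_top {ι : Sort*} {p : ι → B} (h : ⨆ i, p i = ⊤) :
    (⨆ i, embed (p i) : RegularOpen (Iteration X R b)) = ⊤ := by
  refine top_le_iff.1 (RegularOpen.le_iff.2 fun c _ => RegularOpen.mem_of_dense fun c' _ => ?_)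
  have h1 : ∃ i, c'.fst ⊓ p i ≠ ⊥ := by
    by_contra! h2
    refine c'.fst_ne_bot ?_
    rw [← inf_top_eq c'.fst, ← h, inf_iSup_eq]
    simp [h2]
  obtain ⟨i, hi⟩ := h1
  refine ⟨c'.restrict (p i) hi, restrict_le _ _ _, ?_⟩
  exact RegularOpen.le_iff.1 (le_iSup (fun i => embed (p i)) i) _ (mem_embed.2 inf_le_right)

section Trivial

variable (hbt : b = ⊤) (h₂ : BName.isTwoElementVal X R = ⊤)

include hbt in
theorem exists_fst_le {p : B} (hp : p ≠ ⊥) : ∃ c : Iteration X R b, c.fst ≤ p := by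
  have hcba := hb.out
  rw [hbt] at hcba
  unfold BName.isCompleteBooleanAlgebraVal at hcba
  simp only [le_inf_iff] at hcba
  obtain ⟨⟨⟨⟨-, hlub⟩, -⟩, -⟩, hne⟩ := hcba
  have hsub : BName.subsetVal X X = ⊤ := by simp [BName.subsetVal]
  have h1 := hlub.trans (iInf_le _ X)
  rw [hsub, top_himp] at h1
  -- The least upper bound of the whole algebra is a greatest element, hence is not `0`.
  have h2 : ∃ s, p ⊓ BName.isLubVal X R X s ≠ ⊥ := by
    by_contra! h3
    refine hp (le_bot_iff.1 ((le_inf le_rfl (le_top.trans h1)).trans ?_))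
    rw [inf_iSup_eq]
    exact iSup_le fun s => (h3 s).le
  obtain ⟨s, hs⟩ := h2
  set q := p ⊓ BName.isLubVal X R X s with hq
  have hq1 : q ≤ BName.memVal s X := inf_le_right.trans (inf_le_left.trans inf_le_left)
  have hq2 : q ≤ BName.isTopVal X R s := inf_le_right.trans inf_le_left
  have hq3 : q ≤ (BName.isBotVal X R s)ᶜ := by
    have h3 : q ≤ BName.isBotVal X R s ⇨ (BName.isTopVal X R s)ᶜ :=
      le_top.trans (hne.trans (iInf_le _ s))
    rw [le_compl_iff_disjoint_right, disjoint_iff_inf_le]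
    calc q ⊓ BName.isBotVal X R s ≤ BName.isTopVal X R s ⊓ (BName.isTopVal X R s)ᶜ :=
          le_inf (inf_le_left.trans hq2) (le_himp_iff.1 h3)
      _ = ⊥ := inf_compl_self _
  have h4 : ∃ j : X.Index, q ⊓ (X.val j ⊓ BName.eqVal s (X.elt j)) ≠ ⊥ := by
    by_contra! h5
    refine hs (le_bot_iff.1 ((le_inf le_rfl hq1).trans ?_))
    rw [BName.memVal, inf_iSup_eq]
    exact iSup_le fun j => (h5 j).le
  obtain ⟨j, hj⟩ := h4
  refine ⟨⟨_, j, hj, by rw [hbt]; exact le_top, ?_, ?_⟩, inf_le_left.trans inf_le_left⟩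
  · exact inf_le_right.trans (inf_le_left.trans (BName.val_le_memVal X j))
  · have h5 : q ⊓ (X.val j ⊓ BName.eqVal s (X.elt j)) ≤ BName.eqVal s (X.elt j) :=
      inf_le_right.trans inf_le_right
    have h6 := (BName.isBotVal_cong (BName.le_eqVal_refl _ X) (BName.le_eqVal_refl _ R) h5).compl.le
    exact (le_inf le_rfl (inf_le_left.trans hq3)).trans h6

include h₂ in
theorem le_of_fst_le_fst {c c' : Iteration X R b} (h : c.fst ≤ c'.fst) : c ≤ c' := by
  refine ⟨h, ?_⟩
  have h1 : c'.fst ≤ BName.isBotVal X R (X.elt c'.snd) ⊔ BName.isTopVal X R (X.elt c'.snd) :=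
    (le_inf (le_top.trans (h₂.ge.trans (iInf_le _ (X.elt c'.snd)))) c'.forces_mem).trans himp_inf_le
  have h3 : c'.fst ≤ BName.isTopVal X R (X.elt c'.snd) := by
    refine (le_inf h1 c'.forces_ne_zero).trans ?_
    rw [inf_sup_right, inf_compl_self, bot_sup_eq]
    exact inf_le_left
  have h4 : c.fst ≤ BName.memVal (X.elt c.snd) X ⇨ BName.leVal R (X.elt c.snd) (X.elt c'.snd) :=
    h.trans (h3.trans (inf_le_right.trans (iInf_le _ _)))
  exact (le_inf h4 c.forces_mem).trans himp_inf_le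

include hbt h₂ in
/-- Forcing with the two-element algebra adds nothing: the iteration is isomorphic to `B`. -/
theorem nonempty_orderIso : Nonempty (B ≃o RegularOpen (Iteration X R b)) := by
  have hle : ∀ {p q : B},
      (embed p : RegularOpen (Iteration X R b)) ≤ embed q ↔ p ≤ q := by
    intro p q
    refine ⟨fun h => ?_, fun h => RegularOpen.le_iff.2 fun c hc =>
      mem_embed.2 ((mem_embed.1 hc).trans h)⟩
    by_contra hne
    obtain ⟨c, hc⟩ := exists_fst_le (X := X) (R := R) hbt (p := p ⊓ qᶜ) fun h =>
      hne (disjoint_compl_right_iff.1 (disjoint_iff.2 h))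
    have h1 := mem_embed.1 (RegularOpen.le_iff.1 h c (mem_embed.2 (hc.trans inf_le_left)))
    exact c.fst_ne_bot (le_bot_iff.1 ((le_inf h1 (hc.trans inf_le_right)).trans
      (inf_compl_self q).le))
  refine ⟨RelIso.ofSurjective (OrderEmbedding.ofMapLEIff embed fun _ _ => hle) fun U => ?_⟩
  refine ⟨⨆ c : {c // c ∈ U.toLowerSet}, c.1.fst, RegularOpen.ext_toLowerSet fun c => ?_⟩
  refine mem_embed.trans ⟨fun h => RegularOpen.mem_of_dense fun c' hc' => ?_, fun h =>
    le_iSup (fun c : {c // c ∈ U.toLowerSet} => c.1.fst) ⟨c, h⟩⟩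
  have h1 : ∃ d : {c // c ∈ U.toLowerSet}, c'.fst ⊓ d.1.fst ≠ ⊥ := by
    by_contra! h2
    refine c'.fst_ne_bot (le_bot_iff.1 ((le_inf le_rfl (hc'.1.trans h)).trans ?_))
    rw [inf_iSup_eq]
    exact iSup_le fun d => (h2 d).le
  obtain ⟨d, hd⟩ := h1
  exact ⟨c'.restrict _ hd, restrict_le _ _ _,
    U.toLowerSet.lower (le_of_fst_le_fst h₂ inf_le_right) d.2⟩

end Trivial

end Iteration

theorem HasGenericFilters.of_orderIso {B C : Type u} [CompleteBooleanAlgebra B]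
    [CompleteBooleanAlgebra C] (e : B ≃o C) (hB : HasGenericFilters B) : HasGenericFilters C := by
  intro J hJ c
  obtain ⟨G, hG, hc⟩ := hB hJ fun j i => e.symm (c j i)
  have hF : Order.IsPFilter (e.symm ⁻¹' (G : Set B)) := by
    refine Order.IsPFilter.of_def ⟨⊤, ?_⟩ ?_ ?_
    · simp [Order.PFilter.top_mem]
    · intro x hx y hy
      refine ⟨x ⊓ y, ?_, inf_le_left, inf_le_right⟩
      have h1 : e.symm x ⊓ e.symm y ∈ G := Order.PFilter.inf_mem hx hy
      simpa using h1
    · intro x y hxy hx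
      exact Order.PFilter.mem_of_le (e.symm.monotone hxy) hx
  have hmem : ∀ x, x ∈ hF.toPFilter ↔ e.symm x ∈ G := fun x => Iff.rfl
  refine ⟨hF.toPFilter, ?_, fun j => ?_⟩
  · rw [hmem, map_bot]
    exact hG
  · simp only [hmem, map_compl', OrderIso.map_iSup]
    exact hc j

/-- If `Γ` contains the trivial algebra after forcing with a member `B` of `Γ`, then the bounded
forcing axiom for `B` yields the truth of every `Σ₁` statement that is `Γ`-necessary over `V^B`. -/
theorem BoundedForcingAxiom.maximalityPrincipleSigma1 {γ : setLanguage.Formula (Fin 3)}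
    {a : ZFSet.{u}} (htriv : ContainsTrivial γ a)
    (hFA : BoundedForcingAxiom (Cardinal.aleph 1) γ a) :
    MaximalityPrincipleSigma1 (Ordinal.omega 1) γ a := by
  rintro φ hφ A hA ⟨X, R, B, _, hB, hnec⟩
  let f : BName B → BName B → B := fun Y S =>
    BName.classVal γ a Y S ⊓ BName.isTwoElementVal Y S
  have hf : ∀ {e : B} {Y Y' S S' : BName B}, e ≤ BName.eqVal Y Y' → e ≤ BName.eqVal S S' →
      Cong e (f Y S) (f Y' S') := fun hY hS =>
    (BName.classVal_cong γ a hY hS).inf (BName.isTwoElementVal_cong hY hS)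
  obtain ⟨Y, hY⟩ := BName.exists_iSup_le (fun Y => ⨆ S, f Y S) fun Y Y' =>
    (Cong.iSup fun S => hf le_rfl (BName.le_eqVal_refl _ S)).le
  obtain ⟨S, hS⟩ := BName.exists_iSup_le (fun S => f Y S) fun S S' =>
    (hf (BName.le_eqVal_refl _ Y) le_rfl).le
  have htop : f Y S = ⊤ := top_le_iff.1 ((htriv X R B hB).ge.trans (hY.trans hS))
  obtain ⟨h1, h2⟩ := inf_eq_top_iff.1 htop
  obtain ⟨e⟩ := Iteration.nonempty_orderIso (X := Y) (R := S) h1 h2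
  exact realize_of_truth_eq_top (HasGenericFilters.of_orderIso e (hFA.hasGenericFilters hB)) hφ hA
    (hnec Y S)

/-! ### Bounded formulas and canonical names -/

section Formulas

variable {α : Type} {n : ℕ}

/-- A variable, viewed in the scope of one more quantifier. -/
abbrev liftVar (t : α ⊕ Fin n) : α ⊕ Fin (n + 1) := Sum.map id Fin.castSucc t

/-- The variable bound by the innermost quantifier. -/
abbrev newVar : α ⊕ Fin (n + 1) := Sum.inr (Fin.last n)

/-- The bounded quantification `∀ x ∈ t, φ`. -/
def ballFormula (t : α ⊕ Fin n) (φ : setLanguage.BoundedFormula α (n + 1)) :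
    setLanguage.BoundedFormula α n := ((memFormula newVar (liftVar t)).imp φ).all

/-- The bounded quantification `∃ x ∈ t, φ`. -/
def bexFormula (t : α ⊕ Fin n) (φ : setLanguage.BoundedFormula α (n + 1)) :
    setLanguage.BoundedFormula α n := ((memFormula newVar (liftVar t)) ⊓ φ).ex

/-- The atomic formula `s = t`. -/
def eqFormula (s t : α ⊕ Fin n) : setLanguage.BoundedFormula α n :=
  BoundedFormula.equal (Term.var s) (Term.var t)

/-- The variable `t` is not the bound variable number `k`. -/
def AvoidsVar (k : ℕ) (t : α ⊕ Fin n) : Prop := ∀ i, t = Sum.inr i → (i : ℕ) ≠ k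

/-- `Δ₀` formulas that do not mention the bound variable number `k`. -/
inductive IsDelta0Off {α : Type} (k : ℕ) : ∀ {n : ℕ}, setLanguage.BoundedFormula α n → Prop
  | falsum {n : ℕ} : IsDelta0Off k (BoundedFormula.falsum : setLanguage.BoundedFormula α n)
  | eq {n : ℕ} {s t : α ⊕ Fin n} :
      AvoidsVar k s → AvoidsVar k t → IsDelta0Off k (eqFormula s t)
  | mem {n : ℕ} {s t : α ⊕ Fin n} :
      AvoidsVar k s → AvoidsVar k t → IsDelta0Off k (memFormula s t)
  | imp {n : ℕ} {φ ψ : setLanguage.BoundedFormula α n} :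
      IsDelta0Off k φ → IsDelta0Off k ψ → IsDelta0Off k (φ.imp ψ)
  | ball {n : ℕ} {t : α ⊕ Fin n} {φ : setLanguage.BoundedFormula α (n + 1)} :
      AvoidsVar k t → IsDelta0Off k φ → IsDelta0Off k (ballFormula t φ)
  | bex {n : ℕ} {t : α ⊕ Fin n} {φ : setLanguage.BoundedFormula α (n + 1)} :
      AvoidsVar k t → IsDelta0Off k φ → IsDelta0Off k (bexFormula t φ)

theorem AvoidsVar.lift {k : ℕ} {t : α ⊕ Fin n} (h : AvoidsVar k t) : AvoidsVar k (liftVar t) := by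
  rcases t with t | t
  · exact fun i hi => by cases hi
  · rintro i hi
    obtain rfl := Sum.inr.inj hi
    exact h t rfl

theorem AvoidsVar.inl {k : ℕ} (t : α) : AvoidsVar k (Sum.inl t : α ⊕ Fin n) :=
  fun i hi => by cases hi

theorem AvoidsVar.newVar {k : ℕ} (h : k < n) : AvoidsVar k (newVar : α ⊕ Fin (n + 1)) := by
  intro i hi
  obtain rfl := Sum.inr.inj hi
  exact h.ne'

namespace IsDelta0

variable {φ ψ : setLanguage.BoundedFormula α n}

theorem not (hφ : IsDelta0 φ) : IsDelta0 φ.not := hφ.imp .falsum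

theorem inf (hφ : IsDelta0 φ) (hψ : IsDelta0 ψ) : IsDelta0 (φ ⊓ ψ) := (hφ.imp hψ.not).not

theorem memFormula (s t : α ⊕ Fin n) : IsDelta0 (memFormula s t) := .rel _ _

end IsDelta0

namespace IsDelta0Off

variable {k : ℕ} {φ ψ : setLanguage.BoundedFormula α n}

theorem isDelta0 (hφ : IsDelta0Off k φ) : IsDelta0 φ := by
  induction hφ with
  | falsum => exact .falsum
  | eq _ _ => exact .equal _ _
  | mem _ _ => exact .rel _ _
  | imp _ _ h₁ h₂ => exact .imp h₁ h₂
  | ball _ _ h => exact .ball _ h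
  | bex _ _ h => exact .bex _ h

theorem not (hφ : IsDelta0Off k φ) : IsDelta0Off k φ.not := hφ.imp .falsum

theorem inf (hφ : IsDelta0Off k φ) (hψ : IsDelta0Off k ψ) : IsDelta0Off k (φ ⊓ ψ) :=
  (hφ.imp hψ.not).not

theorem sup (hφ : IsDelta0Off k φ) (hψ : IsDelta0Off k ψ) : IsDelta0Off k (φ ⊔ ψ) :=
  hφ.not.imp hψ

end IsDelta0Off

section Realize

variable (v : α → ZFSet.{u}) (xs : Fin n → ZFSet.{u})

@[simp]
theorem sum_elim_snoc_liftVar {M : Type*} (v : α → M) (xs : Fin n → M) (x : M) (t : α ⊕ Fin n) :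
    Sum.elim v (Fin.snoc xs x : Fin (n + 1) → M) (liftVar t) = Sum.elim v xs t :=
  sum_elim_snoc_castSucc v xs x t

@[simp]
theorem sum_elim_snoc_newVar {M : Type*} (v : α → M) (xs : Fin n → M) (x : M) :
    Sum.elim v (Fin.snoc xs x : Fin (n + 1) → M) newVar = x := by simp

@[simp]
theorem realize_ballFormula (t : α ⊕ Fin n) (φ : setLanguage.BoundedFormula α (n + 1)) :
    (ballFormula t φ).Realize v xs ↔ ∀ x ∈ Sum.elim v xs t, φ.Realize v (Fin.snoc xs x) := by
  simp only [ballFormula, BoundedFormula.realize_all, BoundedFormula.realize_imp,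
    realize_memFormula_last]

@[simp]
theorem realize_bexFormula (t : α ⊕ Fin n) (φ : setLanguage.BoundedFormula α (n + 1)) :
    (bexFormula t φ).Realize v xs ↔ ∃ x ∈ Sum.elim v xs t, φ.Realize v (Fin.snoc xs x) := by
  simp only [bexFormula, BoundedFormula.realize_ex, BoundedFormula.realize_inf,
    realize_memFormula_last]

@[simp]
theorem realize_eqFormula (s t : α ⊕ Fin n) :
    (eqFormula s t).Realize v xs ↔ Sum.elim v xs s = Sum.elim v xs t := Iff.rfl

end Realize

namespace BName

variable {C : Type u} [CompleteBooleanAlgebra C]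

theorem eqVal_check_check_of_ne {x y : ZFSet.{u}} (h : x ≠ y) :
    eqVal (check C x) (check C y) = ⊥ := by
  induction x using ZFSet.inductionOn generalizing y with
  | _ x ih =>
    obtain ⟨z, hz⟩ : ∃ z, ¬(z ∈ x ↔ z ∈ y) := by
      by_contra! h'
      exact h (ZFSet.ext h')
    rw [← le_bot_iff]
    by_cases hzx : z ∈ x
    · have hzy : z ∉ y := fun h' => hz (iff_of_true hzx h')
      have h1 := eqVal_inf_memVal_le_right (check C z) (check C x) (check C y)
      rw [memVal_check_check hzx, inf_top_eq, memVal_check] at h1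
      refine h1.trans (iSup_le fun w => (ih z hzx ?_).le)
      rintro rfl
      exact hzy w.2
    · have hzy : z ∈ y := by
        by_contra h'
        exact hz (iff_of_false hzx h')
      have h1 := eqVal_inf_memVal_le_right (check C z) (check C y) (check C x)
      rw [memVal_check_check hzy, inf_top_eq, memVal_check, eqVal_symm] at h1
      refine h1.trans (iSup_le fun w => ?_)
      rw [eqVal_symm]
      refine (ih w.1 w.2 ?_).le
      rintro rfl
      exact hzx w.2

theorem memVal_check_check_of_notMem {x y : ZFSet.{u}} (h : y ∉ x) :
    memVal (check C y) (check C x) = ⊥ := by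
  rw [memVal_check, iSup_eq_bot]
  rintro ⟨z, hz⟩
  exact eqVal_check_check_of_ne (by rintro rfl; exact h hz)

theorem truth_ballFormula (t : α ⊕ Fin n) (φ : setLanguage.BoundedFormula α (n + 1))
    (v : α → BName C) (xs : Fin n → BName C) : truth (ballFormula t φ) v xs =
      ⨅ x, memVal x (Sum.elim v xs t) ⇨ truth φ v (Fin.snoc xs x) := by
  rw [ballFormula, truth]
  exact iInf_congr fun x => by
    rw [truth, truth_memFormula, sum_elim_snoc_liftVar, sum_elim_snoc_newVar]

theorem truth_bexFormula (t : α ⊕ Fin n) (φ : setLanguage.BoundedFormula α (n + 1))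
    (v : α → BName C) (xs : Fin n → BName C) : truth (bexFormula t φ) v xs =
      ⨆ x, memVal x (Sum.elim v xs t) ⊓ truth φ v (Fin.snoc xs x) := by
  rw [bexFormula, truth_ex]
  exact iSup_congr fun x => by
    rw [truth_inf, truth_memFormula, sum_elim_snoc_liftVar, sum_elim_snoc_newVar]

theorem truth_snoc_cong {e : C} (φ : setLanguage.BoundedFormula α (n + 1))
    (v : α → BName C) (xs : Fin n → BName C) {x y : BName C} (h : e ≤ eqVal x y) :
    Cong e (truth φ v (Fin.snoc xs x)) (truth φ v (Fin.snoc xs y)) :=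
  truth_cong φ (fun _ => le_eqVal_refl _ _) fun i => by
    refine Fin.lastCases ?_ (fun i => ?_) i
    · simpa using h
    · simp [le_eqVal_refl]

/-- Absoluteness of `Δ₀` formulas between `V` and `V^C`, where the value of one variable that does
not occur in the formula is arbitrary. -/
theorem truth_check_of_isDelta0Off {k : ℕ} {φ : setLanguage.BoundedFormula α n}
    (hφ : IsDelta0Off k φ) {v : α → BName C} {xs : Fin n → BName C} {v' : α → ZFSet.{u}}
    {xs' : Fin n → ZFSet.{u}} (hv : ∀ i, v i = check C (v' i))
    (hxs : ∀ i : Fin n, (i : ℕ) ≠ k → xs i = check C (xs' i)) :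
    (φ.Realize v' xs' → truth φ v xs = ⊤) ∧ (¬φ.Realize v' xs' → truth φ v xs = ⊥) := by
  have hvar : ∀ {n : ℕ} {xs : Fin n → BName C} {xs' : Fin n → ZFSet.{u}},
      (∀ i : Fin n, (i : ℕ) ≠ k → xs i = check C (xs' i)) → ∀ {t : α ⊕ Fin n}, AvoidsVar k t →
        Sum.elim v xs t = check C (Sum.elim v' xs' t) := by
    intro n xs xs' hxs t ht
    rcases t with t | t
    · exact hv t
    · exact hxs t (ht t rfl)
  have hsnoc : ∀ {n : ℕ} {xs : Fin n → BName C} {xs' : Fin n → ZFSet.{u}},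
      (∀ i : Fin n, (i : ℕ) ≠ k → xs i = check C (xs' i)) → ∀ y : ZFSet.{u}, ∀ i : Fin (n + 1),
        (i : ℕ) ≠ k → (Fin.snoc xs (check C y) : Fin (n + 1) → BName C) i =
          check C ((Fin.snoc xs' y : Fin (n + 1) → ZFSet.{u}) i) := by
    intro n xs xs' hxs y i
    refine Fin.lastCases (fun _ => by simp) (fun i hi => ?_) i
    simpa using hxs i hi
  induction hφ with
  | falsum => exact ⟨fun h => h.elim, fun _ => rfl⟩
  | eq hs ht =>
    rw [realize_eqFormula]
    change (_ → eqVal _ _ = ⊤) ∧ (_ → eqVal _ _ = ⊥)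
    rw [termVal, termVal, hvar hxs hs, hvar hxs ht]
    exact ⟨fun h => by rw [h, eqVal_refl], eqVal_check_check_of_ne⟩
  | mem hs ht =>
    rw [realize_memFormula, truth_memFormula, hvar hxs hs, hvar hxs ht]
    exact ⟨memVal_check_check, memVal_check_check_of_notMem⟩
  | @imp n φ ψ _ _ ih₁ ih₂ =>
    have h₁ := ih₁ hxs
    have h₂ := ih₂ hxs
    rw [BoundedFormula.realize_imp, truth]
    constructor
    · intro hr
      by_cases h : φ.Realize v' xs'
      · rw [h₁.1 h, h₂.1 (hr h), himp_self]
      · rw [h₁.2 h, bot_himp]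
    · intro hr
      obtain ⟨h, h'⟩ := Classical.not_imp.1 hr
      rw [h₁.1 h, h₂.2 h', top_himp]
  | @ball n t φ ht _ ih =>
    have h : ∀ y, _ := fun y => ih (hsnoc hxs y)
    rw [realize_ballFormula, truth_ballFormula, hvar hxs ht]
    constructor
    · intro hr
      refine iInf_eq_top.2 fun x => ?_
      rw [memVal_check, himp_eq_top_iff]
      refine iSup_le fun y => ?_
      have h1 := (truth_snoc_cong φ v xs (le_refl (eqVal x (check C y)))).symm.le
      rwa [(h y).1 (hr y y.2), inf_top_eq] at h1
    · intro hr
      push Not at hr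
      obtain ⟨y, hy, hy'⟩ := hr
      refine le_bot_iff.1 ((iInf_le _ (check C y)).trans ?_)
      rw [memVal_check_check hy, (h y).2 hy', top_himp]
  | @bex n t φ ht _ ih =>
    have h : ∀ y, _ := fun y => ih (hsnoc hxs y)
    rw [realize_bexFormula, truth_bexFormula, hvar hxs ht]
    constructor
    · rintro ⟨y, hy, hy'⟩
      refine top_le_iff.1 (le_iSup_of_le (check C y) ?_)
      rw [memVal_check_check hy, (h y).1 hy', inf_top_eq]
    · intro hr
      push Not at hr
      refine iSup_eq_bot.2 fun x => ?_
      rw [memVal_check, iSup_inf_eq, iSup_eq_bot]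
      intro y
      have h1 := truth_snoc_cong φ v xs (le_refl (eqVal x (check C y)))
      rw [Cong, (h y).2 (hr y y.2), inf_bot_eq] at h1
      exact h1

end BName

/-! ### Formulas about ordered pairs -/

/-- The formula `z = {x, y}`. -/
def upairFormula (z x y : α ⊕ Fin n) : setLanguage.BoundedFormula α n :=
  memFormula x z ⊓ memFormula y z ⊓
    ballFormula z (eqFormula newVar (liftVar x) ⊔ eqFormula newVar (liftVar y))

/-- The formula `z = (x, y)`, for Kuratowski pairs. -/
def pairFormula (z x y : α ⊕ Fin n) : setLanguage.BoundedFormula α n :=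
  bexFormula z <| bexFormula (liftVar z) <|
    upairFormula (liftVar newVar) (liftVar (liftVar x)) (liftVar (liftVar x)) ⊓
    upairFormula newVar (liftVar (liftVar x)) (liftVar (liftVar y)) ⊓
    upairFormula (liftVar (liftVar z)) (liftVar newVar) newVar

/-- The formula `((x, y), c) ∈ F`. -/
def tripleFormula (F x y c : α ⊕ Fin n) : setLanguage.BoundedFormula α n :=
  bexFormula F <| bexFormula newVar <| bexFormula newVar <|
    pairFormula newVar (liftVar (liftVar (liftVar x))) (liftVar (liftVar (liftVar y))) ⊓
    pairFormula (liftVar (liftVar newVar)) newVar (liftVar (liftVar (liftVar c)))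

section

variable {k : ℕ} {x y z c F : α ⊕ Fin n}

theorem isDelta0Off_upairFormula (hk : k < n) (hz : AvoidsVar k z) (hx : AvoidsVar k x)
    (hy : AvoidsVar k y) : IsDelta0Off k (upairFormula z x y) :=
  ((IsDelta0Off.mem hx hz).inf (.mem hy hz)).inf <|
    .ball hz ((IsDelta0Off.eq (.newVar hk) hx.lift).sup (.eq (.newVar hk) hy.lift))

theorem isDelta0Off_pairFormula (hk : k < n) (hz : AvoidsVar k z) (hx : AvoidsVar k x)
    (hy : AvoidsVar k y) : IsDelta0Off k (pairFormula z x y) := by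
  have hk1 : k < n + 1 := hk.trans n.lt_succ_self
  have hk2 : k < n + 1 + 1 := hk1.trans (n + 1).lt_succ_self
  have h1 := (AvoidsVar.newVar (α := α) hk).lift
  have h2 := AvoidsVar.newVar (α := α) hk1
  exact .bex hz <| .bex hz.lift <|
    ((isDelta0Off_upairFormula hk2 h1 hx.lift.lift hx.lift.lift).inf
      (isDelta0Off_upairFormula hk2 h2 hx.lift.lift hy.lift.lift)).inf
      (isDelta0Off_upairFormula hk2 hz.lift.lift h1 h2)

theorem isDelta0Off_tripleFormula (hk : k < n) (hF : AvoidsVar k F) (hx : AvoidsVar k x)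
    (hy : AvoidsVar k y) (hc : AvoidsVar k c) : IsDelta0Off k (tripleFormula F x y c) := by
  have hk1 : k < n + 1 := hk.trans n.lt_succ_self
  have hk2 : k < n + 1 + 1 := hk1.trans (n + 1).lt_succ_self
  have hk3 : k < n + 1 + 1 + 1 := hk2.trans (n + 1 + 1).lt_succ_self
  exact .bex hF <| .bex (.newVar hk) <| .bex (.newVar hk1) <|
    (isDelta0Off_pairFormula hk3 (.newVar hk2) hx.lift.lift.lift hy.lift.lift.lift).inf
      (isDelta0Off_pairFormula hk3 (AvoidsVar.newVar hk).lift.lift (.newVar hk2)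
        hc.lift.lift.lift)

variable (v : α → ZFSet.{u}) (xs : Fin n → ZFSet.{u})

@[simp]
theorem realize_upairFormula : (upairFormula z x y).Realize v xs ↔
    Sum.elim v xs z = {Sum.elim v xs x, Sum.elim v xs y} := by
  simp only [upairFormula, BoundedFormula.realize_inf, realize_memFormula, realize_ballFormula,
    BoundedFormula.realize_sup, realize_eqFormula, sum_elim_snoc_liftVar, sum_elim_snoc_newVar]
  constructor
  · rintro ⟨⟨hx, hy⟩, h⟩
    ext w
    rw [ZFSet.mem_pair]
    refine ⟨h w, ?_⟩
    rintro (rfl | rfl)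
    exacts [hx, hy]
  · intro h
    rw [h]
    simp

@[simp]
theorem realize_pairFormula : (pairFormula z x y).Realize v xs ↔
    Sum.elim v xs z = ZFSet.pair (Sum.elim v xs x) (Sum.elim v xs y) := by
  simp only [pairFormula, BoundedFormula.realize_inf, realize_bexFormula, realize_upairFormula,
    sum_elim_snoc_liftVar, sum_elim_snoc_newVar, ZFSet.pair]
  have h1 : ∀ a : ZFSet.{u}, ({a, a} : ZFSet) = {a} := fun a => by ext; simp
  constructor
  · rintro ⟨a, -, b, -, ⟨rfl, rfl⟩, h⟩
    rw [h, h1]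
  · intro h
    refine ⟨{Sum.elim v xs x}, by simp [h], {Sum.elim v xs x, Sum.elim v xs y}, by simp [h],
      ⟨(h1 _).symm, rfl⟩, h⟩

@[simp]
theorem realize_tripleFormula : (tripleFormula F x y c).Realize v xs ↔
    ZFSet.pair (ZFSet.pair (Sum.elim v xs x) (Sum.elim v xs y)) (Sum.elim v xs c) ∈
      Sum.elim v xs F := by
  simp only [tripleFormula, BoundedFormula.realize_inf, realize_bexFormula, realize_pairFormula,
    sum_elim_snoc_liftVar, sum_elim_snoc_newVar]
  constructor
  · rintro ⟨z, hz, w, -, p, -, rfl, rfl⟩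
    exact hz
  · intro h
    refine ⟨_, h, {ZFSet.pair (Sum.elim v xs x) (Sum.elim v xs y)}, ?_, _, ?_, rfl, rfl⟩
    · rw [ZFSet.pair]; simp
    · simp

end

end Formulas

/-! ### A pairing function on `ω₁` and its `Δ₀` description -/

section PairCoding

variable {α : Type} {n : ℕ}

/-- `F` is the graph of a function `(ξ, i) ↦ γ` on pairs `ξ ∈ i` of elements of `Ω`, with values in
`Ω`. It is the Mostowski collapse of the lexicographic ordering in which `i` is compared first. -/
def IsPairCoding (Ω F : ZFSet.{u}) : Prop :=
  (∀ ξ ∈ Ω, ∀ i ∈ Ω, ξ ∈ i → ∃ γ ∈ Ω, ZFSet.pair (ZFSet.pair ξ i) γ ∈ F) ∧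
  ∀ ξ ∈ Ω, ∀ i ∈ Ω, ∀ γ ∈ Ω, ZFSet.pair (ZFSet.pair ξ i) γ ∈ F →
    (ξ ∈ i ∧ ∀ x ∈ γ, ∃ ξ' ∈ Ω, ∃ i' ∈ Ω,
      ZFSet.pair (ZFSet.pair ξ' i') x ∈ F ∧ (i' ∈ i ∨ i' = i ∧ ξ' ∈ ξ)) ∧
    ∀ ξ' ∈ Ω, ∀ i' ∈ Ω, ∀ γ' ∈ Ω, ZFSet.pair (ZFSet.pair ξ' i') γ' ∈ F →
      (i' ∈ i ∨ i' = i ∧ ξ' ∈ ξ) → γ' ∈ γ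

/-- The formula `(ξ', i') < (ξ, i)` for the lexicographic ordering of `IsPairCoding`. -/
def lexFormula (ξ' i' ξ i : α ⊕ Fin n) : setLanguage.BoundedFormula α n :=
  memFormula i' i ⊔ (eqFormula i' i ⊓ memFormula ξ' ξ)

/-- The formula expressing `IsPairCoding`. -/
def pairCodingFormula (Ω F : α ⊕ Fin n) : setLanguage.BoundedFormula α n :=
  (ballFormula Ω <| ballFormula (liftVar Ω) <| (memFormula (liftVar newVar) newVar).imp <|
    bexFormula (liftVar (liftVar Ω)) <|
      tripleFormula (liftVar (liftVar (liftVar F))) (liftVar (liftVar newVar)) (liftVar newVar)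
        newVar) ⊓
  (ballFormula Ω <| ballFormula (liftVar Ω) <| ballFormula (liftVar (liftVar Ω)) <|
    (tripleFormula (liftVar (liftVar (liftVar F))) (liftVar (liftVar newVar)) (liftVar newVar)
      newVar).imp <|
    (memFormula (liftVar (liftVar newVar)) (liftVar newVar) ⊓
      (ballFormula newVar <| bexFormula (liftVar (liftVar (liftVar (liftVar Ω)))) <|
        bexFormula (liftVar (liftVar (liftVar (liftVar (liftVar Ω))))) <|
          tripleFormula (liftVar (liftVar (liftVar (liftVar (liftVar (liftVar F))))))
            (liftVar newVar) newVar (liftVar (liftVar newVar)) ⊓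
          lexFormula (liftVar newVar) newVar
            (liftVar (liftVar (liftVar (liftVar (liftVar newVar)))))
            (liftVar (liftVar (liftVar (liftVar newVar)))))) ⊓
    (ballFormula (liftVar (liftVar (liftVar Ω))) <|
      ballFormula (liftVar (liftVar (liftVar (liftVar Ω)))) <|
        ballFormula (liftVar (liftVar (liftVar (liftVar (liftVar Ω))))) <|
          (tripleFormula (liftVar (liftVar (liftVar (liftVar (liftVar (liftVar F))))))
            (liftVar (liftVar newVar)) (liftVar newVar) newVar).imp <|
          (lexFormula (liftVar (liftVar newVar)) (liftVar newVar)
            (liftVar (liftVar (liftVar (liftVar (liftVar newVar)))))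
            (liftVar (liftVar (liftVar (liftVar newVar))))).imp <|
          memFormula newVar (liftVar (liftVar (liftVar newVar)))))

theorem isDelta0Off_lexFormula {k : ℕ} {ξ' i' ξ i : α ⊕ Fin n} (hξ' : AvoidsVar k ξ')
    (hi' : AvoidsVar k i') (hξ : AvoidsVar k ξ) (hi : AvoidsVar k i) :
    IsDelta0Off k (lexFormula ξ' i' ξ i) :=
  (IsDelta0Off.mem hi' hi).sup ((IsDelta0Off.eq hi' hi).inf (.mem hξ' hξ))

theorem isDelta0Off_pairCodingFormula {k : ℕ} {Ω F : α ⊕ Fin n} (hk : k < n)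
    (hΩ : AvoidsVar k Ω) (hF : AvoidsVar k F) : IsDelta0Off k (pairCodingFormula Ω F) := by
  unfold pairCodingFormula
  repeat' first
    | assumption
    | apply isDelta0Off_tripleFormula
    | apply isDelta0Off_lexFormula
    | apply IsDelta0Off.ball
    | apply IsDelta0Off.bex
    | apply IsDelta0Off.mem
    | apply IsDelta0Off.inf
    | apply IsDelta0Off.imp
    | apply AvoidsVar.lift
    | apply AvoidsVar.newVar
    | omega

@[simp]
theorem realize_lexFormula {ξ' i' ξ i : α ⊕ Fin n} (v : α → ZFSet.{u}) (xs : Fin n → ZFSet.{u}) :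
    (lexFormula ξ' i' ξ i).Realize v xs ↔ (Sum.elim v xs i' ∈ Sum.elim v xs i ∨
      Sum.elim v xs i' = Sum.elim v xs i ∧ Sum.elim v xs ξ' ∈ Sum.elim v xs ξ) := by
  simp only [lexFormula, BoundedFormula.realize_inf, BoundedFormula.realize_sup,
    realize_memFormula, realize_eqFormula]

@[simp]
theorem realize_pairCodingFormula {Ω F : α ⊕ Fin n} (v : α → ZFSet.{u}) (xs : Fin n → ZFSet.{u}) :
    (pairCodingFormula Ω F).Realize v xs ↔
      IsPairCoding (Sum.elim v xs Ω) (Sum.elim v xs F) := by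
  simp only [pairCodingFormula, BoundedFormula.realize_inf, BoundedFormula.realize_imp,
    realize_ballFormula, realize_bexFormula, realize_tripleFormula, realize_lexFormula,
    realize_memFormula, sum_elim_snoc_liftVar, sum_elim_snoc_newVar, IsPairCoding]

open Cardinal in
/-- There is a pairing function on `ω₁` that is an isomorphism of the set of pairs `ξ < i`, ordered
lexicographically with `i` compared first, with an initial segment of `ω₁`. -/
theorem exists_pairCode : ∃ c : OmegaOne → OmegaOne → OmegaOne,
    (∀ ξ i, ξ < i → ∀ γ, γ < c ξ i ↔
      ∃ ξ' i', ξ' < i' ∧ (i' < i ∨ i' = i ∧ ξ' < ξ) ∧ γ = c ξ' i') ∧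
    ∀ ξ i ξ' i', ξ < i → ξ' < i' → c ξ i = c ξ' i' → ξ = ξ' ∧ i = i' := by
  let S := {q : OmegaOne ×ₗ OmegaOne // (ofLex q).2 < (ofLex q).1}
  have hcount : ∀ s : S, (Iio s).Countable := by
    intro s
    let i := (ofLex s.1).1
    have h1 : (Iic i).Countable := by
      rw [← Iio_union_right]
      exact (OmegaOne.countable_Iio i).union (countable_singleton i)
    refine ((h1.prod h1).preimage (f := fun t : S => ofLex t.1)
      (ofLex.injective.comp Subtype.val_injective)).mono ?_
    intro t ht
    have h2 : (ofLex t.1).1 ≤ i := by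
      have h3 : t.1 < s.1 := ht
      rw [Prod.Lex.lt_iff] at h3
      rcases h3 with h3 | h3
      · exact h3.le
      · exact h3.1.le
    exact ⟨h2, (t.2.trans_le h2).le⟩
  have htype : Ordinal.type (α := S) (· < ·) ≤ Ordinal.type (α := OmegaOne) (· < ·) := by
    rw [Ordinal.type_toType]
    by_contra! h
    obtain ⟨s, hs⟩ := Ordinal.typein_surj (α := S) (· < ·) h
    have h1 := congrArg Ordinal.card hs
    rw [← Ordinal.type_Iio_lt, Ordinal.card_type, Ordinal.card_omega] at h1
    have h2 := le_aleph0_iff_set_countable.2 (hcount s)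
    rw [h1] at h2
    exact absurd h2 (not_le.2 aleph0_lt_aleph_one)
  obtain ⟨f⟩ := Ordinal.type_le_iff.1 htype
  have hf : ∀ {s t : S}, f s < f t ↔ s < t := fun {s t} => f.map_rel_iff
  let mkS : ∀ ξ i : OmegaOne, ξ < i → S := fun ξ i h => ⟨toLex (i, ξ), h⟩
  have hlt : ∀ {ξ i ξ' i'} (h : ξ < i) (h' : ξ' < i'),
      mkS ξ' i' h' < mkS ξ i h ↔ (i' < i ∨ i' = i ∧ ξ' < ξ) := fun h h' => Prod.Lex.lt_iff
  classical
  let c : OmegaOne → OmegaOne → OmegaOne := fun ξ i => if h : ξ < i then f (mkS ξ i h) else ξ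
  have hc : ∀ {ξ i} (h : ξ < i), c ξ i = f (mkS ξ i h) := fun h => dif_pos h
  refine ⟨c, ?_, ?_⟩
  · intro ξ i h γ
    rw [hc h]
    constructor
    · intro hγ
      obtain ⟨t, rfl⟩ := f.mem_range_of_rel hγ
      refine ⟨(ofLex t.1).2, (ofLex t.1).1, t.2, (hlt h t.2).1 (hf.1 hγ), ?_⟩
      rw [hc t.2]
      rfl
    · rintro ⟨ξ', i', h', hl, rfl⟩
      rw [hc h', hf]
      exact (hlt h h').2 hl
  · intro ξ i ξ' i' h h' he
    rw [hc h, hc h'] at he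
    have h1 := congrArg ofLex (congrArg Subtype.val (f.injective he))
    obtain ⟨h2, h3⟩ := Prod.mk.inj h1
    exact ⟨h3, h2⟩

open OmegaOne

variable {c : OmegaOne → OmegaOne → OmegaOne}

/-- The graph of a pairing function, as a set. -/
noncomputable def pairCodeGraph (c : OmegaOne → OmegaOne → OmegaOne) : ZFSet.{u} :=
  ZFSet.range fun p : {p : OmegaOne × OmegaOne // p.1 < p.2} =>
    ZFSet.pair (ZFSet.pair (toZFSet p.1.1) (toZFSet p.1.2)) (toZFSet (c p.1.1 p.1.2))

theorem pair_mem_pairCodeGraph {x : ZFSet.{u}} {ξ i : OmegaOne} :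
    ZFSet.pair (ZFSet.pair (toZFSet ξ) (toZFSet i)) x ∈ pairCodeGraph.{u} c ↔
      ξ < i ∧ x = toZFSet (c ξ i) := by
  simp only [pairCodeGraph, ZFSet.mem_range, ZFSet.pair_inj, Subtype.exists,
    Prod.exists, toZFSet_injective.eq_iff]
  constructor
  · rintro ⟨ξ', i', h, ⟨rfl, rfl⟩, rfl⟩
    exact ⟨h, rfl⟩
  · rintro ⟨h, rfl⟩
    exact ⟨ξ, i, h, ⟨rfl, rfl⟩, rfl⟩

theorem isPairCoding_pairCodeGraph
    (hc : ∀ ξ i, ξ < i → ∀ γ, γ < c ξ i ↔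
      ∃ ξ' i', ξ' < i' ∧ (i' < i ∨ i' = i ∧ ξ' < ξ) ∧ γ = c ξ' i') :
    IsPairCoding (Ordinal.omega.{u} 1).toZFSet (pairCodeGraph c) := by
  simp only [IsPairCoding, exists_mem_toZFSet_omega, forall_mem_toZFSet_omega,
    pair_mem_pairCodeGraph, toZFSet_mem_toZFSet, toZFSet_injective.eq_iff]
  refine ⟨fun ξ i h => ⟨_, h, rfl⟩, ?_⟩
  rintro ξ i γ ⟨h, rfl⟩
  refine ⟨⟨h, ?_⟩, ?_⟩
  · intro x hx
    obtain ⟨γ, hγ, rfl⟩ := mem_toZFSet.1 hx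
    obtain ⟨ξ', i', h', hl, rfl⟩ := (hc ξ i h γ).1 hγ
    exact ⟨ξ', i', ⟨h', rfl⟩, hl⟩
  · rintro ξ' i' γ ⟨h', rfl⟩ hl
    exact (hc ξ i h _).2 ⟨ξ', i', h', hl, rfl⟩

/-- The description of the pairing function determines it. -/
theorem IsPairCoding.eq_code
    (hc : ∀ ξ i, ξ < i → ∀ γ, γ < c ξ i ↔
      ∃ ξ' i', ξ' < i' ∧ (i' < i ∨ i' = i ∧ ξ' < ξ) ∧ γ = c ξ' i')
    {F : ZFSet.{u}} (hF : IsPairCoding (Ordinal.omega.{u} 1).toZFSet F) {ξ i γ : OmegaOne}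
    (h : ZFSet.pair (ZFSet.pair (toZFSet ξ) (toZFSet i)) (toZFSet γ) ∈ F) :
    ξ < i ∧ γ = c ξ i := by
  simp only [IsPairCoding, exists_mem_toZFSet_omega, forall_mem_toZFSet_omega,
    toZFSet_mem_toZFSet, toZFSet_injective.eq_iff] at hF
  obtain ⟨htot, hcol⟩ := hF
  induction i using WellFoundedLT.induction generalizing ξ γ with
  | ind i ihi =>
    induction ξ using WellFoundedLT.induction generalizing γ with
    | ind ξ ihξ =>
      obtain ⟨⟨hlt, h1⟩, h2⟩ := hcol ξ i γ h
      have ih : ∀ {ξ' i' γ'}, (i' < i ∨ i' = i ∧ ξ' < ξ) →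
          ZFSet.pair (ZFSet.pair (toZFSet ξ') (toZFSet i')) (toZFSet γ') ∈ F →
            ξ' < i' ∧ γ' = c ξ' i' := by
        rintro ξ' i' γ' (hl | ⟨rfl, hl⟩) h'
        · exact ihi i' hl h'
        · exact ihξ ξ' hl h'
      refine ⟨hlt, le_antisymm (le_of_forall_lt fun γ' hγ' => ?_)
        (le_of_forall_lt fun γ' hγ' => ?_)⟩
      · obtain ⟨ξ', i', h3, hl⟩ := h1 (toZFSet γ') (toZFSet_mem_toZFSet.2 hγ')
        obtain ⟨h4, rfl⟩ := ih hl h3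
        exact (hc ξ i hlt _).2 ⟨ξ', i', h4, hl, rfl⟩
      · obtain ⟨ξ', i', h4, hl, rfl⟩ := (hc ξ i hlt _).1 hγ'
        obtain ⟨γ'', h5⟩ := htot ξ' i' h4
        obtain ⟨-, rfl⟩ := ih hl h5
        exact h2 ξ' i' _ h5 hl

end PairCoding

/-! ### A `Σ₁` formula asserting the existence of a generic path -/

section PathFormula

variable {α : Type} {n : ℕ}

/-- The union of `A` is `Ω`, the set `F` is the graph of the pairing function on `Ω`, all elements
`x ∈ y` of a member of `W` form a pair whose code belongs to `A`, and for each `ξ ∈ Ω` some member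
of `U` consists of codes of pairs `(ξ, i)`. -/
def IsCodedBy (A Ω F W U : ZFSet.{u}) : Prop :=
  (∀ y ∈ A, ∀ x ∈ y, x ∈ Ω) ∧ (∀ x ∈ Ω, ∃ y ∈ A, x ∈ y) ∧ IsPairCoding Ω F ∧
  (∀ w ∈ W, ∀ x ∈ w, ∀ y ∈ w, x ∈ y → ∃ γ ∈ A, ZFSet.pair (ZFSet.pair x y) γ ∈ F) ∧
  ∀ ξ ∈ Ω, ∃ u ∈ U, ∀ γ ∈ u, γ ∈ Ω ∧ ∃ i ∈ Ω, ZFSet.pair (ZFSet.pair ξ i) γ ∈ F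

/-- Any two members of `g` lie together in a member of `W`, and `g` meets every member of `U`. -/
def IsPath (W U g : ZFSet.{u}) : Prop :=
  (∀ x ∈ g, ∀ y ∈ g, ∃ w ∈ W, x ∈ w ∧ y ∈ w) ∧ ∀ u ∈ U, ∃ γ ∈ g, γ ∈ u

/-- The formula expressing `IsCodedBy`. -/
def codedByFormula (A Ω F W U : α ⊕ Fin n) : setLanguage.BoundedFormula α n :=
  (ballFormula A <| ballFormula newVar <| memFormula newVar (liftVar (liftVar Ω))) ⊓
  ((ballFormula Ω <| bexFormula (liftVar A) <| memFormula (liftVar newVar) newVar) ⊓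
  (pairCodingFormula Ω F ⊓
  ((ballFormula W <| ballFormula newVar <| ballFormula (liftVar newVar) <|
    (memFormula (liftVar newVar) newVar).imp <|
      bexFormula (liftVar (liftVar (liftVar A))) <|
        tripleFormula (liftVar (liftVar (liftVar (liftVar F)))) (liftVar (liftVar newVar))
          (liftVar newVar) newVar) ⊓
  (ballFormula Ω <| bexFormula (liftVar U) <| ballFormula newVar <|
    memFormula newVar (liftVar (liftVar (liftVar Ω))) ⊓
      bexFormula (liftVar (liftVar (liftVar Ω))) (
        tripleFormula (liftVar (liftVar (liftVar (liftVar F))))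
          (liftVar (liftVar (liftVar newVar))) newVar (liftVar newVar))))))

/-- The formula expressing `IsPath`. -/
def pathFormula (W U g : α ⊕ Fin n) : setLanguage.BoundedFormula α n :=
  (ballFormula g <| ballFormula (liftVar g) <| bexFormula (liftVar (liftVar W)) <|
    memFormula (liftVar (liftVar newVar)) newVar ⊓ memFormula (liftVar newVar) newVar) ⊓
  (ballFormula U <| bexFormula (liftVar g) <| memFormula newVar (liftVar newVar))

theorem isDelta0Off_codedByFormula {k : ℕ} {A Ω F W U : α ⊕ Fin n} (hk : k < n)
    (hA : AvoidsVar k A) (hΩ : AvoidsVar k Ω) (hF : AvoidsVar k F) (hW : AvoidsVar k W)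
    (hU : AvoidsVar k U) : IsDelta0Off k (codedByFormula A Ω F W U) := by
  unfold codedByFormula
  repeat' first
    | assumption
    | apply isDelta0Off_pairCodingFormula
    | apply isDelta0Off_tripleFormula
    | apply IsDelta0Off.ball
    | apply IsDelta0Off.bex
    | apply IsDelta0Off.mem
    | apply IsDelta0Off.inf
    | apply IsDelta0Off.imp
    | apply AvoidsVar.lift
    | apply AvoidsVar.newVar
    | omega

theorem isDelta0_pathFormula (W U g : α ⊕ Fin n) : IsDelta0 (pathFormula W U g) :=
  .inf (.ball _ <| .ball _ <| .bex _ <| .inf (.memFormula _ _) (.memFormula _ _))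
    (.ball _ <| .bex _ <| .memFormula _ _)

@[simp]
theorem realize_codedByFormula {A Ω F W U : α ⊕ Fin n} (v : α → ZFSet.{u})
    (xs : Fin n → ZFSet.{u}) : (codedByFormula A Ω F W U).Realize v xs ↔
      IsCodedBy (Sum.elim v xs A) (Sum.elim v xs Ω) (Sum.elim v xs F) (Sum.elim v xs W)
        (Sum.elim v xs U) := by
  simp only [codedByFormula, BoundedFormula.realize_inf, BoundedFormula.realize_imp,
    realize_ballFormula, realize_bexFormula, realize_tripleFormula, realize_pairCodingFormula,
    realize_memFormula, sum_elim_snoc_liftVar, sum_elim_snoc_newVar, IsCodedBy]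

@[simp]
theorem realize_pathFormula {W U g : α ⊕ Fin n} (v : α → ZFSet.{u}) (xs : Fin n → ZFSet.{u}) :
    (pathFormula W U g).Realize v xs ↔
      IsPath (Sum.elim v xs W) (Sum.elim v xs U) (Sum.elim v xs g) := by
  simp only [pathFormula, BoundedFormula.realize_inf, realize_ballFormula, realize_bexFormula,
    realize_memFormula, sum_elim_snoc_liftVar, sum_elim_snoc_newVar, IsPath]

/-- The name `g` that contains the canonical name of `z i` with Boolean value `p i` is a path, if
`W` admits all compatible pairs and every member of `U` supports a supremum equal to `⊤`. -/
theorem BName.truth_pathFormula {C ι : Type u} [CompleteBooleanAlgebra C] (z : ι → ZFSet.{u})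
    (p : ι → C) {W U : ZFSet.{u}} (hW : ∀ i j, p i ⊓ p j ≠ ⊥ → {z i, z j} ∈ W)
    (hU : ∀ u ∈ U, ⨆ i : {i // z i ∈ u}, p i = ⊤) {v : α → BName C} {xs : Fin n → BName C}
    {W' U' g' : α ⊕ Fin n} (hW' : Sum.elim v xs W' = check C W)
    (hU' : Sum.elim v xs U' = check C U)
    (hg' : Sum.elim v xs g' = BName.mk ι (fun i => check C (z i)) p) :
    truth (pathFormula W' U' g') v xs = ⊤ := by
  have hmem : ∀ x, memVal x (BName.mk ι (fun i => check C (z i)) p) =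
      ⨆ i, p i ⊓ eqVal x (check C (z i)) := fun x => rfl
  simp only [pathFormula, truth_inf, truth_ballFormula, truth_bexFormula, truth_memFormula,
    sum_elim_snoc_liftVar, sum_elim_snoc_newVar, hW', hU', hg', inf_eq_top_iff, iInf_eq_top,
    himp_eq_top_iff]
  constructor
  · intro x
    refine le_iInf fun y => ?_
    rw [le_himp_iff, hmem, hmem, iSup_inf_eq]
    refine iSup_le fun i => ?_
    rw [inf_iSup_eq]
    refine iSup_le fun j => ?_
    by_cases h : p i ⊓ p j = ⊥
    · refine (inf_le_inf inf_le_left inf_le_left).trans ?_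
      rw [h]
      exact bot_le
    · refine le_iSup_of_le (check C {z i, z j}) (le_inf ?_ (le_inf ?_ ?_))
      · rw [memVal_check_check (hW i j h)]
        exact le_top
      · rw [memVal_check x]
        exact le_iSup_of_le ⟨z i, by simp⟩ (inf_le_left.trans inf_le_right)
      · rw [memVal_check y]
        exact le_iSup_of_le ⟨z j, by simp⟩ (inf_le_right.trans inf_le_right)
  · intro x
    rw [memVal_check]
    refine iSup_le fun ⟨u, hu⟩ => ?_
    rw [← inf_top_eq (eqVal x _), ← hU u hu, inf_iSup_eq]
    refine iSup_le fun ⟨i, hi⟩ => le_iSup_of_le (check C (z i)) (le_inf ?_ ?_)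
    · rw [hmem]
      exact le_iSup_of_le i (by rw [eqVal_refl, inf_top_eq]; exact inf_le_right)
    · have h := eqVal_inf_memVal_le_right (check C (z i)) (check C u) x
      rw [memVal_check_check hi, inf_top_eq, eqVal_symm] at h
      exact inf_le_left.trans h

/-- The `Σ₁` formula, with `A` as its free variable, expressing that there is a path through the
system coded by `A`. -/
def existsPathFormula : setLanguage.Formula (Fin 1) :=
  (codedByFormula (Sum.inl 0) (Sum.inr 0) (Sum.inr 1) (Sum.inr 2) (Sum.inr 3) ⊓
    pathFormula (Sum.inr 2) (Sum.inr 3) (Sum.inr 4) :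
      setLanguage.BoundedFormula (Fin 1) 5).ex.ex.ex.ex.ex

theorem isDelta0Off_codedByFormula_inr : IsDelta0Off 4
    (codedByFormula (Sum.inl 0) (Sum.inr 0) (Sum.inr 1) (Sum.inr 2) (Sum.inr 3) :
      setLanguage.BoundedFormula (Fin 1) 5) := by
  have h : ∀ j : Fin 5, (j : ℕ) ≠ 4 → AvoidsVar (n := 5) 4 (Sum.inr j : Fin 1 ⊕ Fin 5) :=
    fun j hj i hi => by rwa [← Sum.inr.inj hi]
  exact isDelta0Off_codedByFormula (by omega) (.inl _) (h _ (by decide)) (h _ (by decide))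
    (h _ (by decide)) (h _ (by decide))

theorem isSigma1_existsPathFormula : IsSigma1 existsPathFormula :=
  .ex <| .ex <| .ex <| .ex <| .ex <| .delta0 <|
    isDelta0Off_codedByFormula_inr.isDelta0.inf (isDelta0_pathFormula _ _ _)

theorem snoc_snoc_snoc_snoc_snoc {M : Type*} (xs : Fin 0 → M) (a b c d e : M) :
    (Fin.snoc (Fin.snoc (Fin.snoc (Fin.snoc (Fin.snoc xs a : Fin 1 → M) b : Fin 2 → M) c :
      Fin 3 → M) d : Fin 4 → M) e : Fin 5 → M) = ![a, b, c, d, e] := by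
  ext i
  fin_cases i <;> rfl

theorem realize_existsPathFormula {A : ZFSet.{u}} : existsPathFormula.Realize ![A] ↔
    ∃ Ω F W U g, IsCodedBy A Ω F W U ∧ IsPath W U g := by
  simp only [existsPathFormula, Formula.Realize, BoundedFormula.realize_ex,
    snoc_snoc_snoc_snoc_snoc, BoundedFormula.realize_inf, realize_codedByFormula,
    realize_pathFormula]
  rfl

theorem BName.truth_existsPathFormula {C ι : Type u} [CompleteBooleanAlgebra C]
    (z : ι → ZFSet.{u}) (p : ι → C) {A Ω F W U : ZFSet.{u}} (hA : IsCodedBy A Ω F W U)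
    (hW : ∀ i j, p i ⊓ p j ≠ ⊥ → {z i, z j} ∈ W)
    (hU : ∀ u ∈ U, ⨆ i : {i // z i ∈ u}, p i = ⊤) :
    truth existsPathFormula ![check C A] ![] = ⊤ := by
  rw [← top_le_iff]
  simp only [existsPathFormula, truth_ex]
  refine le_iSup_of_le (check C Ω) <| le_iSup_of_le (check C F) <| le_iSup_of_le (check C W) <|
    le_iSup_of_le (check C U) <|
    le_iSup_of_le (BName.mk ι (fun i => check C (z i)) p) ?_
  rw [snoc_snoc_snoc_snoc_snoc, truth_inf, truth_pathFormula z p hW hU rfl rfl rfl, inf_top_eq,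
    top_le_iff]
  refine (truth_check_of_isDelta0Off (v' := ![A]) (xs' := ![Ω, F, W, U, ∅])
    isDelta0Off_codedByFormula_inr ?_ ?_).1 ?_
  · intro i
    fin_cases i
    rfl
  · intro i hi
    fin_cases i
    · rfl
    · rfl
    · rfl
    · rfl
    · exact (hi rfl).elim
  · rw [realize_codedByFormula]
    exact hA

end PathFormula

/-! ### Finite approximations to a generic filter -/

theorem OmegaOne.exists_gt_of_injOn {s : Set OmegaOne} (hs : ¬s.Countable)
    {f : OmegaOne → OmegaOne} (hf : InjOn f s) (δ : OmegaOne) : ∃ k ∈ s, δ < f k := by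
  by_contra! h
  refine hs (MapsTo.countable_of_injOn (t := Iio δ ∪ {δ}) (fun k hk => ?_) hf
    ((countable_Iio δ).union (countable_singleton δ)))
  rcases (h k hk).lt_or_eq with h | h
  · exact Or.inl h
  · exact Or.inr h

section Approximations

variable {B : Type u} [CompleteBooleanAlgebra B]

theorem IsMaximalAntichain.eq_top_of_forall_le {D : Set B} (hD : IsMaximalAntichain D) {b : B}
    (h : ∀ p ∈ D, p ≤ b) : b = ⊤ := by
  rw [← compl_eq_bot]
  by_contra hb
  obtain ⟨q, hq, hqb⟩ := hD.2.2 _ hb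
  exact hqb (disjoint_iff.1 (disjoint_compl_left_iff.2 (h q hq)))

theorem IsMaximalAntichain.exists_enumeration [Nontrivial B] {D : Set B}
    (hD : IsMaximalAntichain D) (hcard : Cardinal.mk D ≤ Cardinal.aleph 1) :
    ∃ e : OmegaOne → B, range e = D := by
  have h1 : Cardinal.lift.{0} (Cardinal.mk D) ≤ Cardinal.lift.{u} (Cardinal.mk OmegaOne) := by
    rw [OmegaOne.mk_eq]
    simpa using hcard
  obtain ⟨f⟩ := Cardinal.lift_mk_le'.1 h1
  obtain ⟨q, hq, -⟩ := hD.2.2 ⊤ top_ne_bot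
  have : Nonempty D := ⟨⟨q, hq⟩⟩
  refine ⟨fun i => (Function.invFun f i : D), ?_⟩
  ext p
  constructor
  · rintro ⟨i, rfl⟩
    exact (Function.invFun f i).2
  · intro hp
    exact ⟨f ⟨p, hp⟩, congrArg Subtype.val (Function.leftInverse_invFun f.injective ⟨p, hp⟩)⟩

/-- The meet of the finitely many members of the antichains that are selected by `t`. -/
def approx (e : OmegaOne → OmegaOne → B) (t : Finset (OmegaOne × OmegaOne)) : B :=
  t.inf fun q => e q.1 q.2

variable {e : OmegaOne → OmegaOne → B}

theorem iSup_approx_eq_top (he : ∀ η, IsMaximalAntichain (range (e η))) (F : Finset OmegaOne) :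
    ⨆ t : {t : Finset (OmegaOne × OmegaOne) // t.image Prod.fst = F}, approx e t = ⊤ := by
  classical
  induction F using Finset.induction_on with
  | empty =>
    rw [← top_le_iff]
    exact le_iSup_of_le ⟨∅, rfl⟩ (by simp [approx])
  | insert η F _ ih =>
    have h1 : ⨆ j, e η j = ⊤ := (he η).eq_top_of_forall_le (by
      rintro _ ⟨j, rfl⟩
      exact le_iSup (e η) j)
    rw [← top_le_iff, ← inf_top_eq (⊤ : B)]
    nth_rewrite 1 [← h1]
    rw [← ih, iSup_inf_eq]
    refine iSup_le fun j => ?_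
    rw [inf_iSup_eq]
    refine iSup_le fun ⟨t, ht⟩ => le_iSup_of_le ⟨insert (η, j) t, ?_⟩ ?_
    · rw [Finset.image_insert, ht]
    · simp [approx]

/-- Selections from the same antichains are equal or incompatible. -/
theorem approx_le_approx (he : ∀ η, IsMaximalAntichain (range (e η)))
    {t t' : Finset (OmegaOne × OmegaOne)} (h : t.image Prod.fst ⊆ t'.image Prod.fst)
    (hne : approx e t ⊓ approx e t' ≠ ⊥) : approx e t' ≤ approx e t := by
  refine Finset.le_inf fun ⟨η, j⟩ hj => ?_
  obtain ⟨⟨_, j'⟩, hj', rfl⟩ := Finset.mem_image.1 (h (Finset.mem_image_of_mem _ hj))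
  have h1 : approx e t' ≤ _ := Finset.inf_le hj'
  have h2 : approx e t ≤ _ := Finset.inf_le hj
  by_contra hle
  refine hne (le_bot_iff.1 ((inf_le_inf h2 h1).trans (le_of_eq ?_)))
  refine (he _).2.1 _ ⟨_, rfl⟩ _ ⟨_, rfl⟩ fun heq => hle ?_
  exact h1.trans heq.ge

/-- There is a family of finite approximations, arranged along a pairing function, such that a pairwise
compatible choice of one approximation from each column generates a filter that meets all the
antichains. -/
theorem exists_approximation_matrix (he : ∀ η, IsMaximalAntichain (range (e η)))
    {c : OmegaOne → OmegaOne → OmegaOne}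
    (hc : ∀ ξ i ξ' i', ξ < i → ξ' < i' → c ξ i = c ξ' i' → ξ = ξ' ∧ i = i') :
    ∃ d : OmegaOne → B, (∀ ξ, ⨆ i : {i // ξ < i}, d (c ξ i) = ⊤) ∧ ¬{γ | d γ = ⊤}.Countable ∧
      ∀ f : OmegaOne → OmegaOne, (∀ ξ, ξ < f ξ) →
        (∀ ξ η, d (c ξ (f ξ)) ⊓ d (c η (f η)) ≠ ⊥) →
          ∃ G : Order.PFilter B, ⊥ ∉ G ∧ ∀ η, ∃ p ∈ range (e η), p ∈ G := by
  classical
  obtain ⟨F⟩ : Nonempty (OmegaOne ≃ Finset OmegaOne) :=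
    Cardinal.eq.1 (Cardinal.mk_finset_of_infinite _).symm
  -- The factor `OmegaOne` makes every finite set occur at arbitrarily large indices.
  obtain ⟨τ⟩ : Nonempty (Finset (OmegaOne × OmegaOne) × OmegaOne ≃ OmegaOne) := by
    refine Cardinal.eq.1 ?_
    simp [Cardinal.mk_finset_of_infinite]
  let t : OmegaOne → Finset (OmegaOne × OmegaOne) := fun i => (τ.symm i).1
  have ht : ∀ s k, t (τ (s, k)) = s := fun s k => by simp [t]
  have hτ : ∀ s, Function.Injective fun k => τ (s, k) := fun s k k' h =>
    (Prod.mk.inj (τ.injective h)).2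
  let col : OmegaOne → OmegaOne → B := fun ξ i =>
    if (t i).image Prod.fst = F ξ then approx e (t i) else ⊥
  let d : OmegaOne → B := fun γ => ⨆ q : {q : OmegaOne × OmegaOne // q.1 < q.2 ∧ c q.1 q.2 = γ},
    col q.1.1 q.1.2
  have hd : ∀ {ξ i}, ξ < i → d (c ξ i) = col ξ i := by
    intro ξ i h
    refine le_antisymm (iSup_le ?_) (le_iSup_of_le ⟨(ξ, i), h, rfl⟩ le_rfl)
    rintro ⟨⟨ξ', i'⟩, h', heq⟩
    obtain ⟨rfl, rfl⟩ := hc _ _ _ _ h' h heq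
    exact le_rfl
  have hcol : ∀ {ξ i}, (t i).image Prod.fst = F ξ → col ξ i = approx e (t i) := fun h => if_pos h
  refine ⟨d, ?_, ?_, ?_⟩
  · intro ξ
    rw [← top_le_iff, ← iSup_approx_eq_top he (F ξ)]
    refine iSup_le fun ⟨s, hs⟩ => ?_
    obtain ⟨k, -, hk⟩ := OmegaOne.exists_gt_of_injOn not_countable_univ (hτ s).injOn ξ
    refine le_iSup_of_le ⟨_, hk⟩ ?_
    rw [hd hk, hcol (by rw [ht, hs]), ht]
  · -- The column of the empty set takes the value `⊤` uncountably often.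
    intro hcount
    set ξ := F.symm ∅ with hξ
    have h1 : {k | ξ < τ (∅, k)}.Countable := by
      refine MapsTo.countable_of_injOn (f := fun k => c ξ (τ (∅, k))) ?_ ?_ hcount
      · intro k hk
        rw [mem_ofPred_eq, hd hk, hcol (by rw [ht, hξ]; simp), ht]
        simp [approx]
      · intro k hk k' hk' h
        exact hτ _ (hc _ _ _ _ hk hk' h).2
    have h2 : ¬{k | ξ < τ (∅, k)}ᶜ.Countable := fun h => not_countable_univ (by
      rw [← union_compl_self {k | ξ < τ (∅, k)}]
      exact h1.union h)
    obtain ⟨k, hk, hk'⟩ := OmegaOne.exists_gt_of_injOn h2 (hτ ∅).injOn ξ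
    exact hk hk'
  · intro f hf hcompat
    have h1 : ∀ ξ, (t (f ξ)).image Prod.fst = F ξ := by
      intro ξ
      by_contra h
      refine hcompat ξ ξ ?_
      rw [hd (hf ξ), inf_idem]
      exact if_neg h
    have h2 : ∀ ξ, d (c ξ (f ξ)) = approx e (t (f ξ)) := fun ξ => by
      rw [hd (hf ξ), hcol (h1 ξ)]
    simp only [h2] at hcompat
    have hle : ∀ {ξ η}, F ξ ⊆ F η → approx e (t (f η)) ≤ approx e (t (f ξ)) := fun {ξ η} h =>
      approx_le_approx he (by rwa [h1, h1]) (hcompat ξ η)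
    have hG : Order.IsPFilter {p : B | ∃ ξ, approx e (t (f ξ)) ≤ p} := by
      refine Order.IsPFilter.of_def ⟨_, F.symm ∅, le_rfl⟩ ?_ ?_
      · rintro p ⟨ξ, hp⟩ q ⟨η, hq⟩
        refine ⟨_, ⟨F.symm (F ξ ∪ F η), le_rfl⟩, (hle ?_).trans hp, (hle ?_).trans hq⟩
        · simp
        · simp
      · rintro p q hpq ⟨ξ, hp⟩
        exact ⟨ξ, hp.trans hpq⟩
    refine ⟨hG.toPFilter, ?_, ?_⟩
    · rintro ⟨ξ, h⟩
      refine hcompat ξ ξ ?_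
      rw [inf_idem]
      exact le_bot_iff.1 h
    · intro η
      have h3 : η ∈ (t (f (F.symm {η}))).image Prod.fst := by
        rw [h1]
        simp
      obtain ⟨⟨_, j⟩, hj, rfl⟩ := Finset.mem_image.1 h3
      exact ⟨_, ⟨j, rfl⟩, _, Finset.inf_le hj⟩

end Approximations

/-! ### The maximality principle implies the forcing axiom -/

section Converse

open OmegaOne

variable {B : Type u} [CompleteBooleanAlgebra B]

/-- The set of codes of the pairs `ξ < i` such that `d ξ` and `d i` are compatible. -/
noncomputable def compatSet (c : OmegaOne → OmegaOne → OmegaOne) (d : OmegaOne → B) :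
    ZFSet.{u} :=
  ZFSet.range fun p : {p : OmegaOne × OmegaOne // p.1 < p.2 ∧ d p.1 ⊓ d p.2 ≠ ⊥} =>
    toZFSet (c p.1.1 p.1.2)

/-- The set of unordered pairs `{ξ, i}` such that `d ξ` and `d i` are compatible. -/
noncomputable def pairSet (d : OmegaOne → B) : ZFSet.{u} :=
  ZFSet.range fun p : {p : OmegaOne × OmegaOne // d p.1 ⊓ d p.2 ≠ ⊥} =>
    ({toZFSet p.1.1, toZFSet p.1.2} : ZFSet.{u})

/-- The set of columns `{c ξ i | i > ξ}` of the pairing function. -/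
noncomputable def columnSet (c : OmegaOne → OmegaOne → OmegaOne) : ZFSet.{u} :=
  ZFSet.range fun ξ : OmegaOne => ZFSet.range fun i : {i // ξ < i} => toZFSet.{u} (c ξ i)

variable {c : OmegaOne → OmegaOne → OmegaOne} {d : OmegaOne → B}

theorem toZFSet_mem_compatSet
    (hinj : ∀ ξ i ξ' i', ξ < i → ξ' < i' → c ξ i = c ξ' i' → ξ = ξ' ∧ i = i') {ξ i : OmegaOne}
    (h : ξ < i) : toZFSet (c ξ i) ∈ compatSet c d ↔ d ξ ⊓ d i ≠ ⊥ := by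
  simp only [compatSet, ZFSet.mem_range, Subtype.exists, Prod.exists, toZFSet_injective.eq_iff]
  constructor
  · rintro ⟨ξ', i', ⟨h', hne⟩, heq⟩
    obtain ⟨rfl, rfl⟩ := hinj _ _ _ _ h' h heq
    exact hne
  · intro hne
    exact ⟨ξ, i, ⟨h, hne⟩, rfl⟩

theorem exists_lt_mem_compatSet [Nontrivial B]
    (hinj : ∀ ξ i ξ' i', ξ < i → ξ' < i' → c ξ i = c ξ' i' → ξ = ξ' ∧ i = i')
    (hd : ¬{γ | d γ = ⊤}.Countable) (δ : OmegaOne) :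
    ∃ γ, δ < γ ∧ toZFSet γ ∈ compatSet c d := by
  obtain ⟨ξ, hξ⟩ : {γ | d γ = ⊤}.Nonempty := by
    rw [nonempty_iff_ne_empty]
    intro h
    exact hd (h ▸ countable_empty)
  have h1 : ¬({γ | d γ = ⊤} ∩ Ioi ξ).Countable := by
    intro h
    refine hd ((h.union ((countable_Iio ξ).union (countable_singleton ξ))).mono ?_)
    intro i hi
    rcases lt_trichotomy i ξ with h | h | h
    · exact Or.inr (Or.inl h)
    · exact Or.inr (Or.inr h)
    · exact Or.inl ⟨hi, h⟩
  obtain ⟨i, ⟨hi, hi'⟩, hlt⟩ := exists_gt_of_injOn h1 (f := c ξ)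
    (fun i hi j hj h => (hinj _ _ _ _ hi.2 hj.2 h).2) δ
  refine ⟨_, hlt, (toZFSet_mem_compatSet hinj hi').2 ?_⟩
  rw [mem_ofPred_eq] at hξ hi
  rw [hξ, hi, inf_top_eq]
  exact top_ne_bot

theorem isCodedBy_compatSet [Nontrivial B]
    (hc : ∀ ξ i, ξ < i → ∀ γ, γ < c ξ i ↔
      ∃ ξ' i', ξ' < i' ∧ (i' < i ∨ i' = i ∧ ξ' < ξ) ∧ γ = c ξ' i')
    (hinj : ∀ ξ i ξ' i', ξ < i → ξ' < i' → c ξ i = c ξ' i' → ξ = ξ' ∧ i = i')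
    (hd : ¬{γ | d γ = ⊤}.Countable) :
    IsCodedBy (compatSet c d) (Ordinal.omega.{u} 1).toZFSet (pairCodeGraph c) (pairSet d)
      (columnSet c) := by
  refine ⟨?_, ?_, isPairCoding_pairCodeGraph hc, ?_, ?_⟩
  · intro y hy x hx
    obtain ⟨p, rfl⟩ := ZFSet.mem_range.1 hy
    obtain ⟨i, -, rfl⟩ := mem_toZFSet.1 hx
    exact mem_toZFSet_omega.2 ⟨i, rfl⟩
  · refine forall_mem_toZFSet_omega.2 fun δ => ?_
    obtain ⟨γ, hγ, hmem⟩ := exists_lt_mem_compatSet hinj hd δ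
    exact ⟨_, hmem, toZFSet_mem_toZFSet.2 hγ⟩
  · intro w hw x hx y hy hxy
    obtain ⟨⟨⟨i, j⟩, hij⟩, rfl⟩ := ZFSet.mem_range.1 hw
    have key : ∀ {i j : OmegaOne}, d i ⊓ d j ≠ ⊥ → toZFSet.{u} i ∈ toZFSet.{u} j →
        ∃ γ ∈ compatSet c d,
          ZFSet.pair (ZFSet.pair (toZFSet i) (toZFSet j)) γ ∈ pairCodeGraph c := by
      intro i j hij h
      rw [toZFSet_mem_toZFSet] at h
      exact ⟨_, (toZFSet_mem_compatSet hinj h).2 hij, pair_mem_pairCodeGraph.2 ⟨h, rfl⟩⟩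
    rw [ZFSet.mem_pair] at hx hy
    rcases hx with rfl | rfl <;> rcases hy with rfl | rfl
    · exact (ZFSet.mem_irrefl _ hxy).elim
    · exact key hij hxy
    · exact key (by rwa [inf_comm]) hxy
    · exact (ZFSet.mem_irrefl _ hxy).elim
  · refine forall_mem_toZFSet_omega.2 fun ξ => ⟨_, ZFSet.mem_range.2 ⟨ξ, rfl⟩, ?_⟩
    intro γ hγ
    obtain ⟨⟨i, hi⟩, rfl⟩ := ZFSet.mem_range.1 hγ
    exact ⟨mem_toZFSet_omega.2 ⟨_, rfl⟩, _, mem_toZFSet_omega.2 ⟨i, rfl⟩,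
      pair_mem_pairCodeGraph.2 ⟨hi, rfl⟩⟩

/-- A path through the system coded by `compatSet c d` chooses pairwise compatible conditions, one
from each column. -/
theorem exists_compatible_choice [Nontrivial B]
    (hc : ∀ ξ i, ξ < i → ∀ γ, γ < c ξ i ↔
      ∃ ξ' i', ξ' < i' ∧ (i' < i ∨ i' = i ∧ ξ' < ξ) ∧ γ = c ξ' i')
    (hinj : ∀ ξ i ξ' i', ξ < i → ξ' < i' → c ξ i = c ξ' i' → ξ = ξ' ∧ i = i')
    (hd : ¬{γ | d γ = ⊤}.Countable) {Ω F W U g : ZFSet.{u}}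
    (hA : IsCodedBy (compatSet c d) Ω F W U) (hg : IsPath W U g) :
    ∃ f : OmegaOne → OmegaOne, (∀ ξ, ξ < f ξ) ∧
      ∀ ξ η, d (c ξ (f ξ)) ⊓ d (c η (f η)) ≠ ⊥ := by
  obtain ⟨hΩ₁, hΩ₂, hF, hW, hU⟩ := hA
  obtain ⟨hgW, hgU⟩ := hg
  -- The set of codes is unbounded in `ω₁`, so the formula defines `ω₁` as its union.
  obtain rfl : Ω = (Ordinal.omega.{u} 1).toZFSet := by
    ext x
    constructor
    · intro hx
      obtain ⟨y, hy, hxy⟩ := hΩ₂ x hx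
      obtain ⟨p, rfl⟩ := ZFSet.mem_range.1 hy
      obtain ⟨i, -, rfl⟩ := mem_toZFSet.1 hxy
      exact mem_toZFSet_omega.2 ⟨i, rfl⟩
    · intro hx
      obtain ⟨δ, rfl⟩ := mem_toZFSet_omega.1 hx
      obtain ⟨γ, hγ, hmem⟩ := exists_lt_mem_compatSet hinj hd δ
      exact hΩ₁ _ hmem _ (toZFSet_mem_toZFSet.2 hγ)
  have hcompat : ∀ {x y : OmegaOne}, toZFSet x ∈ g → toZFSet y ∈ g → x < y → d x ⊓ d y ≠ ⊥ := by
    intro x y hx hy hxy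
    obtain ⟨w, hw, hxw, hyw⟩ := hgW _ hx _ hy
    obtain ⟨γ, hγ, hγF⟩ := hW w hw _ hxw _ hyw (toZFSet_mem_toZFSet.2 hxy)
    obtain ⟨⟨⟨i, j⟩, hij⟩, rfl⟩ := ZFSet.mem_range.1 hγ
    obtain ⟨-, h⟩ := hF.eq_code hc hγF
    obtain ⟨rfl, rfl⟩ := hinj _ _ _ _ hij.1 hxy h
    exact hij.2
  have hchoice : ∀ ξ, ∃ i, ξ < i ∧ toZFSet (c ξ i) ∈ g := by
    intro ξ
    obtain ⟨u, hu, hu'⟩ := hU _ (mem_toZFSet_omega.2 ⟨ξ, rfl⟩)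
    obtain ⟨γ, hγ, hγu⟩ := hgU u hu
    obtain ⟨hγΩ, i, hi, h⟩ := hu' γ hγu
    obtain ⟨γ, rfl⟩ := mem_toZFSet_omega.1 hγΩ
    obtain ⟨i, rfl⟩ := mem_toZFSet_omega.1 hi
    obtain ⟨hlt, rfl⟩ := hF.eq_code hc h
    exact ⟨i, hlt, hγ⟩
  choose f hf hfg using hchoice
  have hne : ∀ ξ η, ξ ≠ η → d (c ξ (f ξ)) ⊓ d (c η (f η)) ≠ ⊥ := ?_
  · refine ⟨f, hf, fun ξ η => ?_⟩
    rcases eq_or_ne ξ η with rfl | h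
    -- Compatibility with the choice in any other column shows that a condition is not `⊥`.
    · intro h
      rw [inf_idem] at h
      exact hne ξ (f ξ) (hf ξ).ne (by rw [h, bot_inf_eq])
    · exact hne ξ η h
  intro ξ η hne
  rcases lt_trichotomy (c ξ (f ξ)) (c η (f η)) with h | h | h
  · exact hcompat (hfg ξ) (hfg η) h
  · exact (hne (hinj _ _ _ _ (hf ξ) (hf η) h).1).elim
  · rw [inf_comm]
    exact hcompat (hfg η) (hfg ξ) h

/-- The canonical name of the generic filter of `B` yields a path in every extension by a two-step
iteration that starts with `B`, whatever the second step is. -/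
theorem isNecessaryOver_existsPathFormula [Nontrivial B]
    (hc : ∀ ξ i, ξ < i → ∀ γ, γ < c ξ i ↔
      ∃ ξ' i', ξ' < i' ∧ (i' < i ∨ i' = i ∧ ξ' < ξ) ∧ γ = c ξ' i')
    (hinj : ∀ ξ i ξ' i', ξ < i → ξ' < i' → c ξ i = c ξ' i' → ξ = ξ' ∧ i = i')
    (hd : ¬{γ | d γ = ⊤}.Countable) (hcol : ∀ ξ, ⨆ i : {i // ξ < i}, d (c ξ i) = ⊤)
    (γ : setLanguage.Formula (Fin 3)) (a : ZFSet.{u}) :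
    IsNecessaryOver B γ a existsPathFormula (compatSet c d) := by
  intro X R
  refine BName.truth_existsPathFormula (fun i : ULift.{u} OmegaOne => toZFSet i.down)
    (fun i => Iteration.embed (d i.down)) (isCodedBy_compatSet hc hinj hd) ?_ ?_
  · rintro ⟨i⟩ ⟨j⟩ h
    exact ZFSet.mem_range.2 ⟨⟨(i, j), fun h' => h (Iteration.embed_inf_embed_eq_bot h')⟩, rfl⟩
  · intro u hu
    obtain ⟨ξ, rfl⟩ := ZFSet.mem_range.1 hu
    rw [← top_le_iff, ← Iteration.iSup_embed_eq_top (hcol ξ)]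
    exact iSup_le fun i => le_iSup_of_le ⟨⟨c ξ i⟩, ZFSet.mem_range.2 ⟨i, rfl⟩⟩ le_rfl

theorem MaximalityPrincipleSigma1.boundedForcingAxiom {γ : setLanguage.Formula (Fin 3)}
    {a : ZFSet.{u}} (hMP : MaximalityPrincipleSigma1 (Ordinal.omega 1) γ a) :
    BoundedForcingAxiom (Cardinal.aleph 1) γ a := by
  intro X R B _ hB D hD
  have : Nontrivial B := hB.2.1
  choose e he using fun η : OmegaOne =>
    (hD η.toOrd).1.exists_enumeration (hD η.toOrd).2
  obtain ⟨c, hc, hinj⟩ := exists_pairCode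
  obtain ⟨d, hcol, hd, hfilter⟩ := exists_approximation_matrix (e := e)
    (fun η => by rw [he]; exact (hD _).1) hinj
  have h := hMP existsPathFormula isSigma1_existsPathFormula (compatSet c d) (fun x hx => by
    obtain ⟨p, rfl⟩ := ZFSet.mem_range.1 hx
    exact mem_toZFSet_omega.2 ⟨_, rfl⟩)
    ⟨X, R, B, _, hB, isNecessaryOver_existsPathFormula hc hinj hd hcol γ a⟩
  obtain ⟨Ω, F, W, U, g, hA, hg⟩ := realize_existsPathFormula.1 h
  obtain ⟨f, hf, hcompat⟩ := exists_compatible_choice hc hinj hd hA hg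
  obtain ⟨G, hG, hmeet⟩ := hfilter f hf hcompat
  refine ⟨G, hG, fun ξ => ?_⟩
  obtain ⟨η, rfl⟩ : ∃ η : OmegaOne, ξ = η.toOrd := ⟨Ordinal.ToType.mk ξ, by simp⟩
  rw [← he]
  exact hmeet η

end Converse

theorem mainTheorem1 (γ : setLanguage.Formula (Fin 3)) (a : ZFSet.{u})
    (htriv : ContainsTrivial γ a) :
    BoundedForcingAxiom (Cardinal.aleph 1) γ a ↔
      MaximalityPrincipleSigma1 (Ordinal.omega 1) γ a :=
  ⟨fun h => BoundedForcingAxiom.maximalityPrincipleSigma1 htriv h,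
    fun h => MaximalityPrincipleSigma1.boundedForcingAxiom h⟩
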